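/- **Setting.** There are $n\ge 1$ tasks (clients). Task $i$ has a data distribution $\mathbf D_i$ and a loss $\ell_i(w;z)$, twice differentiable in $w\in\mathbb R^d$, with risk $\mathcal L_i(w)=\mathbb E_{z\sim \mathbf D_i}[\ell_i(w;z)]$, also twice differentiable. For a fixed $\alpha\ge 0$ put $v_i(w)=w-\alpha\nabla\mathcal L_i(w)$ and $$F(w)=\frac1n\sum_{i=1}^n\mathcal L_i\bigl(v_i(w)\bigr).$$ Let $\|\cdot\|$ be the Euclidean norm of vectors and the spectral norm of matrices. Assume that for all $i,w,w'$: * $\|\nabla\mathcal L_i(w)-\nabla\mathcal L_i(w')\|\le L\|w-w'\|$ and $\|\nabla^2\mathcal L_i(w)-\nabla^2\mathcal L_i(w')\|\le\rho\|w-w'\|$; * for $z\sim\mathbf D_i$, $\nabla\ell_i(w;z)$ and $\nabla^2\ell_i(w;z)$ are square-integrable unbiased estimators of $\nabla\mathcal L_i(w)$ and $\nabla^2\mathcal L_i(w)$, with $\mathbb E\|\nabla\ell_i(w;z)-\nabla\mathcal L_i(w)\|^2\le\sigma_G^2$ and $\mathbb E\|\nabla^2\ell_i(w;z)-\nabla^2\mathcal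 L_i(w)\|^2\le\sigma_H^2$; * $\|\nabla\mathcal L_i(w)\|\le G$; * $F$ is bounded below. **Algorithm (LocalMOML with full participation, $B=n$).** Start from a meta-model $w_1$ and personalized models $u^i_{0,H}$ (square-integrable, possibly random, independent of all samples). In round $r=1,\dots,R$, every client $i$ sets $w^i_{r,1}=w_r$, $u^i_{r,0}=u^i_{r-1,H}$, and for $h=1,\dots,H$ draws fresh batches $\mathcal S_1,\mathcal S_2,\mathcal S_3$ of $K$ samples each from $\mathbf D_i$ (all samples of all clients and iterations are independent) and sets $$u^i_{r,h}=(1-\beta)u^i_{r,h-1}+\beta\bigl(w^i_{r,h}-\alpha\widehat\nabla_{\mathcal S_1}\mathcal L_i(w^i_{r,h})\bigr),\qquad w^i_{r,h+1}=w^i_{r,h}-\eta\bigl(I-\alpha\widehat\nabla^2_{\mathcal S_2}\mathcal L_i(w^i_{r,h})\bigr)\widehat\nabla_{\mathcal S_3}\mathcal L_i(u^i_{r,h}),$$ where $\widehat\nabla_{\mathcal S}$, $\widehat\nabla^2_{\mathcal S}$ are averages of $\nabla\ell_i$, $\nabla^2\ell_i$ over the batch. The server then sets $w_{r+1}=\frac1n\sum_{i=1}^n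 w^i_{r,H+1}$, which is one communication round. **Corollary (Cross-silo setting).** Let $L,\rho,\sigma_G,\sigma_H,G,\alpha,\Delta,U\ge0$. There are constants $c_\beta,c_\eta,c_H,c_R,C>0$, depending only on these numbers (in particular not on $n$, $d$, $K$ or $\varepsilon$), such that for all tasks as above with $F(w_1)-\inf F\le\Delta$ and $\frac1n\sum_{i=1}^n\mathbb E\|u^i_{0,H}-v_i(w_1)\|^2\le U$, every batch size $K\ge1$ and every $\varepsilon\in(0,1]$, LocalMOML with $$\beta=c_\beta\varepsilon^2\in(0,1],\qquad \eta=c_\eta\varepsilon^3,\qquad H=\lceil c_H\varepsilon^{-2}\rceil,\qquad R=\lceil c_R\varepsilon^{-3}\rceil$$ satisfies $$\frac1R\sum_{r=1}^R\mathbb E\|\nabla F(w_r)\|^2\le\varepsilon^2\qquad\text{and}\qquad \mathbb E\|\nabla F(w_\tau)\|\le\varepsilon$$ for $\tau$ uniform on $\{1,\dots,R\}$ and independent of everything else, where all $\|\nabla F(w_r)\|^2$ are integrable. So it reaches an $\varepsilon$-stationary point. It uses at most $C\varepsilon^{-3}$ communication rounds, at most $T=RH\le C\varepsilon^{-5}$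 local iterations of each client, and at most $CKn\varepsilon^{-5}$ data samples in total, that is, $\mathcal O(n\varepsilon^{-5})$ samples for $K=\mathcal O(1)$. -/

import Mathlib

open MeasureTheory ProbabilityTheory

noncomputable section

namespace MetaLearning

/-- The space `ℝ^d` of models, with the Euclidean norm. -/
abbrev Model (d : ℕ) := EuclideanSpace ℝ (Fin d)

/-- A family of `n` learning tasks (clients): task `i` has a data distribution `D i` on the
sample space `Z` and a loss function `loss i w z`. -/
structure Tasks (n d : ℕ) (Z : Type*) [MeasurableSpace Z] where
  D : Fin n → Measure Z
  prob : ∀ i, IsProbabilityMeasure (D i)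
  loss : Fin n → Model d → Z → ℝ

variable {n d : ℕ} {Z : Type*} [MeasurableSpace Z]

namespace Tasks

variable (P : Tasks n d Z)

/-- The gradient `∇ℓ_i(w; z)` in the model variable. -/
def sampleGrad (i : Fin n) (w : Model d) (z : Z) : Model d :=
  gradient (fun w' => P.loss i w' z) w

/-- The Hessian `∇²ℓ_i(w; z)` in the model variable, as a linear operator (whose operator norm is
the spectral norm). -/
def sampleHess (i : Fin n) (w : Model d) (z : Z) : Model d →L[ℝ] Model d :=
  fderiv ℝ (fun w' => P.sampleGrad i w' z) w

/-- The risk `𝓛_i(w) = E_{z ∼ D_i} ℓ_i(w, z)`. -/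
def risk (i : Fin n) (w : Model d) : ℝ := ∫ z, P.loss i w z ∂(P.D i)

def riskGrad (i : Fin n) (w : Model d) : Model d := gradient (P.risk i) w

def riskHess (i : Fin n) (w : Model d) : Model d →L[ℝ] Model d := fderiv ℝ (P.riskGrad i) w

/-- The personalized model `v_i(w) = w - α ∇𝓛_i(w)`: one exact gradient step on task `i`. -/
def adapt (α : ℝ) (i : Fin n) (w : Model d) : Model d := w - α • P.riskGrad i w

/-- The meta-objective `F(w) = (1/n) ∑ i, 𝓛_i(w - α ∇𝓛_i(w))`. -/
def metaObjective (α : ℝ) (w : Model d) : ℝ :=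
  (n : ℝ)⁻¹ * ∑ i, P.risk i (P.adapt α i w)

/-- The losses are measurable and integrable in the sample and twice differentiable in the model,
the risks are twice differentiable, and the stochastic gradients and Hessians are square-integrable
unbiased estimators of the gradients and Hessians of the risks. -/
structure Regular : Prop where
  integrable_loss : ∀ i w, Integrable (P.loss i w) (P.D i)
  differentiable_loss : ∀ i z, Differentiable ℝ (fun w => P.loss i w z)
  differentiable_sampleGrad : ∀ i z, Differentiable ℝ (fun w => P.sampleGrad i w z)
  measurable_sampleGrad : ∀ i, Measurable (fun p : Model d × Z => P.sampleGrad i p.1 p.2)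
  measurable_sampleHess : ∀ i, Measurable (fun p : Model d × Z => P.sampleHess i p.1 p.2)
  memLp_sampleGrad : ∀ i w, MemLp (P.sampleGrad i w) 2 (P.D i)
  memLp_sampleHess : ∀ i w, MemLp (P.sampleHess i w) 2 (P.D i)
  differentiable_risk : ∀ i, Differentiable ℝ (P.risk i)
  differentiable_riskGrad : ∀ i, Differentiable ℝ (P.riskGrad i)
  unbiased_grad : ∀ i w, ∫ z, P.sampleGrad i w z ∂(P.D i) = P.riskGrad i w
  unbiased_hess : ∀ i w, ∫ z, P.sampleHess i w z ∂(P.D i) = P.riskHess i w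

/-- Every risk has an `L`-Lipschitz gradient and a `ρ`-Lipschitz Hessian. -/
def SmoothRisks (L ρ : ℝ) : Prop :=
  ∀ i w w', ‖P.riskGrad i w - P.riskGrad i w'‖ ≤ L * ‖w - w'‖ ∧
    ‖P.riskHess i w - P.riskHess i w'‖ ≤ ρ * ‖w - w'‖

/-- The variances of the stochastic gradients and Hessians are at most `σG²` and `σH²`. -/
def BoundedVariance (σG σH : ℝ) : Prop :=
  ∀ i w, ∫ z, ‖P.sampleGrad i w z - P.riskGrad i w‖ ^ 2 ∂(P.D i) ≤ σG ^ 2 ∧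
    ∫ z, ‖P.sampleHess i w z - P.riskHess i w‖ ^ 2 ∂(P.D i) ≤ σH ^ 2

/-- The gradients of the risks are bounded by `G`. -/
def BoundedGradients (G : ℝ) : Prop := ∀ i w, ‖P.riskGrad i w‖ ≤ G

/-- The mini-batch gradient of `𝓛_i` at `w` on the batch `S` of size `K`. -/
def batchGrad {K : ℕ} (i : Fin n) (S : Fin K → Z) (w : Model d) : Model d :=
  (K : ℝ)⁻¹ • ∑ k, P.sampleGrad i w (S k)

/-- The mini-batch Hessian of `𝓛_i` at `w` on the batch `S` of size `K`. -/
def batchHess {K : ℕ} (i : Fin n) (S : Fin K → Z) (w : Model d) : Model d →L[ℝ] Model d :=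
  (K : ℝ)⁻¹ • ∑ k, P.sampleHess i w (S k)

end Tasks

/-- The state of one client: its personalized model `u`, its local copy `w` of the meta-model, and
the numbers of local iterations made and of data samples drawn so far. -/
structure ClientState (d : ℕ) where
  u : Model d
  w : Model d
  iterations : ℕ
  samples : ℕ

/-- The state of the whole system between two rounds: the meta-model `w` of the server, the
personalized models `u i` of the clients, the number of communication rounds made so far, and the
numbers of local iterations and of data samples of each client so far. -/
structure SystemState (n d : ℕ) where
  w : Model d
  u : Fin n → Model d
  rounds : ℕ
  iterations : Fin n → ℕ
  samples : Fin n → ℕ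

/-- One local iteration of client `i` with the batches `S 0`, `S 1`, `S 2` of size `K`:
`u⁺ = (1 - β) u + β (w - α ∇_{S 0} 𝓛_i(w))` and
`w⁺ = w - η (I - α ∇²_{S 1} 𝓛_i(w)) ∇_{S 2} 𝓛_i(u⁺)`. -/
def localStep (P : Tasks n d Z) (α β η : ℝ) {K : ℕ} (i : Fin n) (S : Fin 3 → Fin K → Z)
    (s : ClientState d) : ClientState d :=
  let u' := (1 - β) • s.u + β • (s.w - α • P.batchGrad i (S 0) s.w)
  let g := P.batchGrad i (S 2) u'
  { u := u'
    w := s.w - η • (g - α • P.batchHess i (S 1) s.w g)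
    iterations := s.iterations + 1
    samples := s.samples + 3 * K }

/-- `h` consecutive local iterations of client `i`; iteration `m` uses the batches `S m`. -/
def localSteps (P : Tasks n d Z) (α β η : ℝ) {K : ℕ} (i : Fin n) (S : ℕ → Fin 3 → Fin K → Z)
    (s : ClientState d) : ℕ → ClientState d
  | 0 => s
  | h + 1 => localStep P α β η i (S h) (localSteps P α β η i S s h)

/-- One round with full participation: every client receives the meta-model, keeps its own
personalized model, makes `H` local iterations and sends its local meta-model to the server, which
averages. -/
def round (P : Tasks n d Z) (α β η : ℝ) (H : ℕ) {K : ℕ} (S : Fin n → ℕ → Fin 3 → Fin K → Z)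
    (s : SystemState n d) : SystemState n d :=
  let c : Fin n → ClientState d := fun i =>
    localSteps P α β η i (S i)
      { u := s.u i, w := s.w, iterations := s.iterations i, samples := s.samples i } H
  { w := (n : ℝ)⁻¹ • ∑ i, (c i).w
    u := fun i => (c i).u
    rounds := s.rounds + 1
    iterations := fun i => (c i).iterations
    samples := fun i => (c i).samples }

/-- The index of a single data sample: client, round, local iteration, batch number (there are
three batches in each local iteration), position in the batch of size `K`. -/
abbrev SampleIndex (n K : ℕ) := Fin n × ℕ × ℕ × Fin 3 × Fin K

/-- LocalMOML in the cross-silo setting (full participation), with initial meta-model `w₁` and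
initial personalized models `u₀ i`, run on the data `z`: the state after `r` rounds. The meta-model
at the beginning of the rounds `1, …, R` is the `w` of the states `0, …, R - 1`. -/
def localMOML (P : Tasks n d Z) (α β η : ℝ) (H : ℕ) {K : ℕ} (w₁ : Model d) (u₀ : Fin n → Model d)
    (z : SampleIndex n K → Z) : ℕ → SystemState n d
  | 0 => { w := w₁, u := u₀, rounds := 0, iterations := fun _ => 0, samples := fun _ => 0 }
  | r + 1 => round P α β η H (fun i h b k => z (i, r, h, b, k)) (localMOML P α β η H w₁ u₀ z r)

/-- The expectation of `f τ`, for a round `τ` drawn uniformly from the first `R` rounds,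
independently of everything else. -/
def expectAtUniformRound {Ω : Type*} [MeasurableSpace Ω] (μ : Measure Ω) (R : ℕ)
    (f : ℕ → Ω → ℝ) : ℝ :=
  (R : ℝ)⁻¹ * ∑ r ∈ Finset.range R, ∫ ω, f r ω ∂μ

/-- The data samples and the random initial personalized models of a run: the samples of client `i`
are distributed as `D i`, all samples are independent, and the initial personalized models are
square-integrable and independent of the samples. -/
structure RunData {Ω : Type*} [MeasurableSpace Ω] (μ : Measure Ω) (P : Tasks n d Z) (K : ℕ)
    (S : SampleIndex n K → Ω → Z) (u₀ : Fin n → Ω → Model d) : Prop where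
  law : ∀ j, HasLaw (S j) (P.D j.1) μ
  indep : iIndepFun S μ
  memLp_init : ∀ i, MemLp (u₀ i) 2 μ
  indep_init : IndepFun (fun ω i => u₀ i ω) (fun ω j => S j ω) μ

end MetaLearning

end

/-! LocalMOML is a biased local SGD on `F`. The gradient of `F` at `w` is the mean over `i` of `(I -
α ∇²𝓛_i(w)) ∇𝓛_i(v_i(w))`, so the direction of a client carries two systematic errors: it is taken
at the client's own model instead of the average of all local models (drift), and with `u` in place
of `v_i(w)` (lag). The batches are fresh and independent of each other. Given the past, the
stochastic direction therefore has mean `metaGrad` at `(w, u)`, and its second moment is at most a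
constant `M = directionBound`.

Drift: within a round a local model makes at most `H` steps of length `η` times a direction, so its
mean squared distance from the server model is at most `(Hη)² M`
(`integral_sq_norm_loc_sub_glob_le`).

Lag: `u` is a moving average of noisy copies of `v_i(w)`. Its fresh noise is orthogonal to the old
lag, and the motion of `w` is absorbed by Young's inequality with weight `β`. The mean squared lag
thus contracts by `1 - β` per iteration towards a level of order `β + η²/β²`
(`integral_sq_norm_lag_succ_le`). The server's averaging displaces the local models by an amount of
the order of the drift. Since `(1 - β)^H ≤ 1/4`, the mean squared lag is nevertheless halved in
every round up to such errors (`integral_sq_norm_lag_round_le`), and its sum over the rounds is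
controlled by the initial lag and `R` times these errors.

Descent: the average of the local models performs steps along the averaged direction and agrees with
the server model at the ends of the rounds. The descent inequality and `2⟪g, q⟫ ≥ ‖g‖² - ‖g - q‖²`
bound `‖∇F‖²` by the decrease of `F` plus drift and lag (`meanSqGrad_le`). Telescoping gives a bound
of order `Δ/(ηHR) + U/R + (Hη)² + β + η²/β² + η` (`average_meanSqGrad_le`). For `β ~ ε²`, `η ~ ε³`,
`H ~ ε⁻²`, `R ~ ε⁻³` every term is `O(ε²)`, and small enough constants give `ε²` itself. No
cancellation of noise within a batch or between clients is exploited, only Jensen's inequality, so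
the constants do not involve `K` or `n`. -/

namespace MetaLearning

open scoped RealInnerProductSpace

/-! ### Gradient of the meta-objective and Lipschitz bounds of the directions. -/

/-- The hypotheses on the tasks: smoothness and boundedness of the risks, and bounded variance of
the stochastic oracles. -/
structure Tasks.Admissible {n d : ℕ} {Z : Type*} [MeasurableSpace Z] (P : Tasks n d Z)
    (L ρ σG σH G α : ℝ) : Prop where
  n_pos : 0 < n
  L_nonneg : 0 ≤ L
  ρ_nonneg : 0 ≤ ρ
  G_nonneg : 0 ≤ G
  α_nonneg : 0 ≤ α
  regular : P.Regular
  smooth : P.SmoothRisks L ρ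
  variance : P.BoundedVariance σG σH
  bounded : P.BoundedGradients G

/-- The Lipschitz constant of `w ↦ w - α ∇𝓛(w)` for an `L`-smooth risk `𝓛`. -/
noncomputable def adaptLip (L α : ℝ) : ℝ := 1 + α * L

/-- The Lipschitz constant of the gradient of the meta-objective. -/
noncomputable def metaLip (L ρ G α : ℝ) : ℝ := α * ρ * G + adaptLip L α * L * adaptLip L α

namespace Tasks

variable {n d : ℕ} {Z : Type*} [MeasurableSpace Z] (P : Tasks n d Z)

/-- The direction `(I - α ∇²𝓛_i(w)) ∇𝓛_i(u)`, which is the gradient at `w` of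
`𝓛_i(w - α ∇𝓛_i(w))` for `u = w - α ∇𝓛_i(w)`. -/
noncomputable def metaGrad (α : ℝ) (i : Fin n) (w u : Model d) : Model d :=
  P.riskGrad i u - α • P.riskHess i w (P.riskGrad i u)

variable {P} {L ρ σG σH G α : ℝ}

theorem Regular.hasFDerivAt_risk (h : P.Regular) (i : Fin n) (w : Model d) :
    HasFDerivAt (P.risk i) (innerSL ℝ (P.riskGrad i w)) w := by
  have := (h.differentiable_risk i w).hasGradientAt
  exact this.hasFDerivAt

theorem Regular.hasFDerivAt_riskGrad (h : P.Regular) (i : Fin n) (w : Model d) :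
    HasFDerivAt (P.riskGrad i) (P.riskHess i w) w :=
  (h.differentiable_riskGrad i w).hasFDerivAt

/-- Symmetry of second derivatives. It lets the adjoint that the chain rule produces in the gradient
of `F` be replaced by the Hessian itself. -/
theorem Regular.inner_riskHess (h : P.Regular) (i : Fin n) (w x y : Model d) :
    ⟪P.riskHess i w x, y⟫ = ⟪x, P.riskHess i w y⟫ := by
  have h2 := (innerSL ℝ : Model d →L[ℝ] Model d →L[ℝ] ℝ).hasFDerivAt.comp w
    (h.hasFDerivAt_riskGrad i w)
  have := second_derivative_symmetric (h.hasFDerivAt_risk i) h2 x y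
  have h3 : ⟪P.riskHess i w x, y⟫ = ⟪P.riskHess i w y, x⟫ := this
  rw [h3, real_inner_comm]

theorem Regular.hasGradientAt_risk_adapt (h : P.Regular) (α : ℝ) (i : Fin n) (w : Model d) :
    HasGradientAt (fun w => P.risk i (P.adapt α i w))
      (P.metaGrad α i w (P.adapt α i w)) w := by
  have h1 : HasFDerivAt (P.adapt α i) (ContinuousLinearMap.id ℝ _ - α • P.riskHess i w) w :=
    (hasFDerivAt_id w).sub ((h.hasFDerivAt_riskGrad i w).const_smul α)
  have h2 := (h.hasFDerivAt_risk i (P.adapt α i w)).comp w h1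
  rw [hasGradientAt_iff_hasFDerivAt]
  refine h2.congr_fderiv ?_
  ext x
  simp [metaGrad, h.inner_riskHess]

theorem Regular.hasGradientAt_metaObjective (h : P.Regular) (α : ℝ) (w : Model d) :
    HasGradientAt (P.metaObjective α)
      ((n : ℝ)⁻¹ • ∑ i, P.metaGrad α i w (P.adapt α i w)) w := by
  rw [hasGradientAt_iff_hasFDerivAt]
  have := (HasFDerivAt.fun_sum (u := Finset.univ)
    (fun i _ => (h.hasGradientAt_risk_adapt α i w).hasFDerivAt)).const_mul (n : ℝ)⁻¹
  refine this.congr_fderiv ?_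
  ext x
  simp

theorem Regular.gradient_metaObjective (h : P.Regular) (α : ℝ) (w : Model d) :
    gradient (P.metaObjective α) w = (n : ℝ)⁻¹ • ∑ i, P.metaGrad α i w (P.adapt α i w) :=
  (h.hasGradientAt_metaObjective α w).gradient

namespace Admissible

theorem adaptLip_pos (h : P.Admissible L ρ σG σH G α) : 1 ≤ adaptLip L α := by
  have := mul_nonneg h.α_nonneg h.L_nonneg
  unfold adaptLip; linarith

theorem metaLip_nonneg (h : P.Admissible L ρ σG σH G α) : 0 ≤ metaLip L ρ G α := by
  have h1 := h.adaptLip_pos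
  have := h.L_nonneg
  have := h.ρ_nonneg
  have := h.G_nonneg
  have := h.α_nonneg
  unfold metaLip; positivity

theorem norm_riskHess_le (h : P.Admissible L ρ σG σH G α) (i : Fin n) (w : Model d) :
    ‖P.riskHess i w‖ ≤ L :=
  norm_fderiv_le_of_lip' ℝ h.L_nonneg (Filter.Eventually.of_forall fun x => (h.smooth i x w).1)

theorem norm_sub_smul_riskHess_le (h : P.Admissible L ρ σG σH G α) (i : Fin n) (w x : Model d) :
    ‖x - α • P.riskHess i w x‖ ≤ adaptLip L α * ‖x‖ := by
  have h1 : ‖P.riskHess i w x‖ ≤ L * ‖x‖ :=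
    (P.riskHess i w).le_of_opNorm_le (h.norm_riskHess_le i w) x
  calc ‖x - α • P.riskHess i w x‖ ≤ ‖x‖ + ‖α • P.riskHess i w x‖ := norm_sub_le _ _
    _ = ‖x‖ + α * ‖P.riskHess i w x‖ := by rw [norm_smul, Real.norm_of_nonneg h.α_nonneg]
    _ ≤ ‖x‖ + α * (L * ‖x‖) := by gcongr; exact h.α_nonneg
    _ = adaptLip L α * ‖x‖ := by unfold adaptLip; ring

theorem norm_adapt_sub_le (h : P.Admissible L ρ σG σH G α) (i : Fin n) (w w' : Model d) :
    ‖P.adapt α i w - P.adapt α i w'‖ ≤ adaptLip L α * ‖w - w'‖ := by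
  have : P.adapt α i w - P.adapt α i w'
      = (w - w') - α • (P.riskGrad i w - P.riskGrad i w') := by
    simp only [adapt, smul_sub]; abel
  rw [this]
  calc _ ≤ ‖w - w'‖ + ‖α • (P.riskGrad i w - P.riskGrad i w')‖ := norm_sub_le _ _
    _ = ‖w - w'‖ + α * ‖P.riskGrad i w - P.riskGrad i w'‖ := by
        rw [norm_smul, Real.norm_of_nonneg h.α_nonneg]
    _ ≤ ‖w - w'‖ + α * (L * ‖w - w'‖) := by
        gcongr
        · exact h.α_nonneg
        · exact (h.smooth i w w').1
    _ = adaptLip L α * ‖w - w'‖ := by unfold adaptLip; ring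

theorem norm_metaGrad_le (h : P.Admissible L ρ σG σH G α) (i : Fin n) (w u : Model d) :
    ‖P.metaGrad α i w u‖ ≤ adaptLip L α * G := by
  refine (h.norm_sub_smul_riskHess_le i w _).trans ?_
  have := h.adaptLip_pos
  gcongr
  exact h.bounded i u

/-- The two arguments are changed one at a time: the operator at `w'` acts on the difference of the
gradients, and the difference of the Hessians acts on a single gradient. The second term is a
product, which is why a uniform bound `G` is needed besides the Lipschitz constants. -/
theorem norm_metaGrad_sub_le (h : P.Admissible L ρ σG σH G α) (i : Fin n)
    (w u w' u' : Model d) :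
    ‖P.metaGrad α i w u - P.metaGrad α i w' u'‖
      ≤ α * ρ * G * ‖w - w'‖ + adaptLip L α * L * ‖u - u'‖ := by
  set x := P.riskGrad i u - P.riskGrad i u'
  have e : P.metaGrad α i w u - P.metaGrad α i w' u'
      = (x - α • P.riskHess i w' x)
        - α • (P.riskHess i w - P.riskHess i w') (P.riskGrad i u) := by
    simp only [metaGrad, x, map_sub, smul_sub, sub_apply]; abel
  have h1 : ‖x - α • P.riskHess i w' x‖ ≤ adaptLip L α * (L * ‖u - u'‖) := by
    refine (h.norm_sub_smul_riskHess_le i w' x).trans ?_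
    have := h.adaptLip_pos
    gcongr
    exact (h.smooth i u u').1
  have h2 : ‖(P.riskHess i w - P.riskHess i w') (P.riskGrad i u)‖ ≤ ρ * ‖w - w'‖ * G := by
    refine (ContinuousLinearMap.le_opNorm _ _).trans ?_
    have := h.ρ_nonneg
    gcongr
    · exact (h.smooth i w w').2
    · exact h.bounded i u
  rw [e]
  calc _ ≤ ‖x - α • P.riskHess i w' x‖
        + ‖α • (P.riskHess i w - P.riskHess i w') (P.riskGrad i u)‖ := norm_sub_le _ _
    _ = ‖x - α • P.riskHess i w' x‖
        + α * ‖(P.riskHess i w - P.riskHess i w') (P.riskGrad i u)‖ := by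
        rw [norm_smul, Real.norm_of_nonneg h.α_nonneg]
    _ ≤ adaptLip L α * (L * ‖u - u'‖) + α * (ρ * ‖w - w'‖ * G) := by
        gcongr
        exact h.α_nonneg
    _ = _ := by ring

end Admissible

end Tasks

/-! ### Norms of averages. -/

/-- The norm of an average is at most a common bound of the norms. -/
theorem norm_average_le {ι E : Type*} [Fintype ι] [Nonempty ι] [NormedAddCommGroup E]
    [NormedSpace ℝ E] (x : ι → E) {c : ℝ} (hx : ∀ i, ‖x i‖ ≤ c) :
    ‖(Fintype.card ι : ℝ)⁻¹ • ∑ i, x i‖ ≤ c := by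
  have hn : (0 : ℝ) < Fintype.card ι := by exact_mod_cast Fintype.card_pos
  rw [norm_smul, Real.norm_of_nonneg (by positivity), inv_mul_le_iff₀ hn]
  calc ‖∑ i, x i‖ ≤ ∑ _i : ι, c := norm_sum_le_of_le _ fun i _ => hx i
    _ = _ := by simp

/-- Jensen's inequality: the squared norm of an average is at most the average of the squared
norms. -/
theorem sq_norm_average_le {ι E : Type*} [Fintype ι] [Nonempty ι] [NormedAddCommGroup E]
    [NormedSpace ℝ E] (x : ι → E) :
    ‖(Fintype.card ι : ℝ)⁻¹ • ∑ i, x i‖ ^ 2 ≤ (Fintype.card ι : ℝ)⁻¹ * ∑ i, ‖x i‖ ^ 2 := by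
  have hn : (0 : ℝ) < Fintype.card ι := by exact_mod_cast Fintype.card_pos
  rw [norm_smul, Real.norm_of_nonneg (by positivity), mul_pow, inv_pow, sq (Fintype.card ι : ℝ),
    mul_inv, mul_assoc]
  gcongr
  rw [inv_mul_le_iff₀ hn]
  calc ‖∑ i, x i‖ ^ 2 ≤ (∑ i, ‖x i‖) ^ 2 := by gcongr; exact norm_sum_le _ _
    _ ≤ _ := by simpa using sq_sum_le_card_mul_sum_sq (s := Finset.univ) (f := fun i => ‖x i‖)

theorem sq_norm_average_fin_le {m : ℕ} (hm : 0 < m) {E : Type*} [NormedAddCommGroup E]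
    [NormedSpace ℝ E] (x : Fin m → E) :
    ‖(m : ℝ)⁻¹ • ∑ i, x i‖ ^ 2 ≤ (m : ℝ)⁻¹ * ∑ i, ‖x i‖ ^ 2 := by
  have : Nonempty (Fin m) := ⟨⟨0, hm⟩⟩
  simpa using sq_norm_average_le x

theorem norm_average_fin_le {m : ℕ} (hm : 0 < m) {E : Type*} [NormedAddCommGroup E]
    [NormedSpace ℝ E] (x : Fin m → E) {c : ℝ} (hx : ∀ i, ‖x i‖ ≤ c) :
    ‖(m : ℝ)⁻¹ • ∑ i, x i‖ ≤ c := by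
  have : Nonempty (Fin m) := ⟨⟨0, hm⟩⟩
  simpa using norm_average_le x hx

/-- A constant is its own average. -/
theorem average_fin_const {m : ℕ} (hm : 0 < m) {E : Type*} [AddCommGroup E] [Module ℝ E] (x : E) :
    (m : ℝ)⁻¹ • ∑ _i : Fin m, x = x := by
  have : (m : ℝ) ≠ 0 := by positivity
  rw [Finset.sum_const, Finset.card_univ, Fintype.card_fin, ← Nat.cast_smul_eq_nsmul ℝ, smul_smul,
    inv_mul_cancel₀ this, one_smul]

theorem sq_norm_add_le_two_mul {E : Type*} [SeminormedAddCommGroup E] (x y : E) :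
    ‖x + y‖ ^ 2 ≤ 2 * ‖x‖ ^ 2 + 2 * ‖y‖ ^ 2 := by
  have h := norm_add_le x y
  have h0 := norm_nonneg (x + y)
  nlinarith [sq_nonneg (‖x‖ - ‖y‖)]

theorem sq_norm_sub_le_two_mul {E : Type*} [SeminormedAddCommGroup E] (x y : E) :
    ‖x - y‖ ^ 2 ≤ 2 * ‖x‖ ^ 2 + 2 * ‖y‖ ^ 2 := by
  simpa [sub_eq_add_neg] using sq_norm_add_le_two_mul x (-y)

/-! ### Smoothness of the meta-objective. -/

namespace Tasks.Admissible

variable {n d : ℕ} {Z : Type*} [MeasurableSpace Z] {P : Tasks n d Z} {L ρ σG σH G α : ℝ}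

theorem norm_gradient_metaObjective_le (h : P.Admissible L ρ σG σH G α) (w : Model d) :
    ‖gradient (P.metaObjective α) w‖ ≤ adaptLip L α * G := by
  rw [h.regular.gradient_metaObjective]
  exact norm_average_fin_le h.n_pos _ fun i => h.norm_metaGrad_le i _ _

theorem norm_metaGrad_adapt_sub_le (h : P.Admissible L ρ σG σH G α) (i : Fin n)
    (w w' : Model d) :
    ‖P.metaGrad α i w (P.adapt α i w) - P.metaGrad α i w' (P.adapt α i w')‖
      ≤ metaLip L ρ G α * ‖w - w'‖ := by
  refine (h.norm_metaGrad_sub_le i _ _ _ _).trans ?_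
  have h1 := h.norm_adapt_sub_le i w w'
  have := h.adaptLip_pos
  have := h.L_nonneg
  calc _ ≤ α * ρ * G * ‖w - w'‖ + adaptLip L α * L * (adaptLip L α * ‖w - w'‖) := by gcongr
    _ = _ := by unfold metaLip; ring

theorem norm_gradient_metaObjective_sub_le (h : P.Admissible L ρ σG σH G α) (w w' : Model d) :
    ‖gradient (P.metaObjective α) w - gradient (P.metaObjective α) w'‖
      ≤ metaLip L ρ G α * ‖w - w'‖ := by
  rw [h.regular.gradient_metaObjective, h.regular.gradient_metaObjective, ← smul_sub,
    ← Finset.sum_sub_distrib]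
  exact norm_average_fin_le h.n_pos _ fun i => h.norm_metaGrad_adapt_sub_le i w w'

theorem continuous_gradient_metaObjective (h : P.Admissible L ρ σG σH G α) :
    Continuous (gradient (P.metaObjective α)) :=
  (LipschitzWith.of_dist_le' (K := metaLip L ρ G α) fun x y => by
    simpa [dist_eq_norm] using h.norm_gradient_metaObjective_sub_le x y).continuous

theorem _root_.MetaLearning.Tasks.norm_fderiv_metaObjective_sub (P : Tasks n d Z) (α : ℝ)
    (w w' : Model d) :
    ‖fderiv ℝ (P.metaObjective α) w - fderiv ℝ (P.metaObjective α) w'‖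
      = ‖gradient (P.metaObjective α) w - gradient (P.metaObjective α) w'‖ := by
  rw [gradient, gradient, ← map_sub, LinearIsometryEquiv.norm_map]

/-- The descent inequality for the meta-objective. -/
theorem metaObjective_le (h : P.Admissible L ρ σG σH G α) (w w' : Model d) :
    P.metaObjective α w' ≤ P.metaObjective α w
      + ⟪gradient (P.metaObjective α) w, w' - w⟫ + metaLip L ρ G α * ‖w' - w‖ ^ 2 := by
  have hd : Differentiable ℝ (P.metaObjective α) := fun x =>
    (h.regular.hasGradientAt_metaObjective α x).differentiableAt
  -- On the ball of radius `‖w' - w‖` the derivative differs from the one at `w` by at most `metaLip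
  -- * ‖w' - w‖`. The mean value inequality then yields the quadratic term without the usual factor
  -- `1/2`.
  have key := (convex_closedBall w ‖w' - w‖).norm_image_sub_le_of_norm_fderiv_le'
    (f := P.metaObjective α) (φ := fderiv ℝ (P.metaObjective α) w) (x := w) (y := w')
    (C := metaLip L ρ G α * ‖w' - w‖)
    (fun x _ => hd x)
    (fun x hx => by
      rw [norm_fderiv_metaObjective_sub]
      refine (h.norm_gradient_metaObjective_sub_le x w).trans ?_
      have := h.metaLip_nonneg
      gcongr
      simpa [dist_eq_norm] using hx)
    (Metric.mem_closedBall_self (norm_nonneg _)) (by simp [dist_eq_norm])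
  rw [inner_gradient_left]
  have := (le_abs_self _).trans key
  nlinarith

/-- The gradient of `F` is bounded, so `F` grows at most linearly. This makes `F` integrable at
square-integrable random models. -/
theorem abs_metaObjective_sub_le (h : P.Admissible L ρ σG σH G α) (w w' : Model d) :
    |P.metaObjective α w - P.metaObjective α w'| ≤ adaptLip L α * G * ‖w - w'‖ := by
  have hd : Differentiable ℝ (P.metaObjective α) := fun x =>
    (h.regular.hasGradientAt_metaObjective α x).differentiableAt
  refine convex_univ.norm_image_sub_le_of_norm_fderiv_le (𝕜 := ℝ) (fun x _ => hd x)
    (fun x _ => ?_) (Set.mem_univ w') (Set.mem_univ w)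
  rw [← toDual_gradient, LinearIsometryEquiv.norm_map]
  exact h.norm_gradient_metaObjective_le x

theorem continuous_metaObjective (h : P.Admissible L ρ σG σH G α) :
    Continuous (P.metaObjective α) :=
  continuous_iff_continuousAt.2 fun x =>
    (h.regular.hasGradientAt_metaObjective α x).differentiableAt.continuousAt

end Tasks.Admissible

/-! ### Independence of the history and averaging over a fresh sample. -/

section Independence

variable {Ω J E Z : Type*} [MeasurableSpace E] [MeasurableSpace Z]

/-- The `σ`-algebra generated by the random variable `u₀` and the random variables `S j` with
`j ∈ A`. -/
@[reducible] def history (u₀ : Ω → E) (S : J → Ω → Z) (A : Set J) : MeasurableSpace Ω :=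
  MeasurableSpace.comap u₀ inferInstance ⊔ ⨆ j ∈ A, MeasurableSpace.comap (S j) inferInstance

theorem history_mono (u₀ : Ω → E) (S : J → Ω → Z) {A B : Set J} (h : A ⊆ B) :
    history u₀ S A ≤ history u₀ S B :=
  sup_le_sup_left (biSup_mono h) _

theorem measurable_history_init (u₀ : Ω → E) (S : J → Ω → Z) (A : Set J) :
    Measurable[history u₀ S A] u₀ :=
  measurable_iff_comap_le.2 le_sup_left

theorem measurable_history_sample (u₀ : Ω → E) (S : J → Ω → Z) {A : Set J} {j : J} (hj : j ∈ A) :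
    Measurable[history u₀ S A] (S j) :=
  measurable_iff_comap_le.2 <| le_sup_of_le_right <|
    le_iSup₂ (f := fun j (_ : j ∈ A) => MeasurableSpace.comap (S j) inferInstance) j hj

variable [MeasurableSpace Ω] {μ : Measure Ω}

theorem history_le {u₀ : Ω → E} {S : J → Ω → Z} (hu : Measurable u₀) (hS : ∀ j, Measurable (S j))
    (A : Set J) : history u₀ S A ≤ ‹MeasurableSpace Ω› :=
  sup_le hu.comap_le (iSup₂_le fun j _ => (hS j).comap_le)

/-- The initial models count as one more member, with index `none`, of the independent family of
samples. Disjoint sets of indices then generate independent `σ`-algebras. -/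
theorem iIndep_option_comap {u₀ : Ω → E} {S : J → Ω → Z} (hS : iIndepFun S μ)
    (hu : IndepFun u₀ (fun ω j => S j ω) μ) :
    iIndep (fun o : Option J => o.elim (MeasurableSpace.comap u₀ inferInstance)
      fun j => MeasurableSpace.comap (S j) inferInstance) μ := by
  have := hS.isProbabilityMeasure
  rw [iIndep_iff]
  intro s f hf
  have hS' := (iIndep_iff _ μ).1 hS.iIndep s.eraseNone (f := fun j => f (some j))
    (fun j hj => hf (some j) (by simpa using hj))
  by_cases hn : none ∈ s
  · have hs : s = Finset.insertNone s.eraseNone := by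
      ext o; cases o <;> simp [hn]
    have e1 : ⋂ o ∈ s, f o = f none ∩ ⋂ j ∈ s.eraseNone, f (some j) := by
      ext ω
      simp only [Set.mem_iInter, Set.mem_inter_iff, Finset.mem_eraseNone]
      exact ⟨fun h => ⟨h _ hn, fun j hj => h _ hj⟩, fun h o ho => by
        cases o with
        | none => exact h.1
        | some j => exact h.2 j ho⟩
    have e2 : ∏ o ∈ s, μ (f o) = μ (f none) * ∏ j ∈ s.eraseNone, μ (f (some j)) := by
      conv_lhs => rw [hs]
      rw [Finset.prod_insertNone]
    rw [e1, e2, ← hS']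
    refine (Indep_iff _ _ μ).1 ((IndepFun_iff_Indep _ _ μ).1 hu) _ _ (hf none hn) ?_
    refine Finset.measurableSet_biInter _ fun j hj => ?_
    obtain ⟨t, ht, hft⟩ := hf (some j) (by simpa using hj)
    exact ⟨_, measurable_pi_apply j ht, hft⟩
  · have hs : s = s.eraseNone.map Function.Embedding.some := by
      ext o; cases o <;> simp [hn]
    have e2 : ∏ o ∈ s, μ (f o) = ∏ j ∈ s.eraseNone, μ (f (some j)) := by
      conv_lhs => rw [hs]
      simp
    have e1 : ⋂ o ∈ s, f o = ⋂ j ∈ s.eraseNone, f (some j) := by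
      conv_lhs => rw [hs]
      ext ω
      simp
    rw [e1, e2, hS']

/-- A sample is independent of the history that does not contain it. -/
theorem indep_history {u₀ : Ω → E} {S : J → Ω → Z} (hS : iIndepFun S μ)
    (hu : IndepFun u₀ (fun ω j => S j ω) μ) (hmu : Measurable u₀) (hmS : ∀ j, Measurable (S j))
    {A : Set J} {j : J} (hj : j ∉ A) :
    Indep (history u₀ S A) (MeasurableSpace.comap (S j) inferInstance) μ := by
  have key := indep_iSup_of_disjoint
    (m := fun o : Option J => o.elim (MeasurableSpace.comap u₀ inferInstance)
      fun j => MeasurableSpace.comap (S j) inferInstance)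
    (fun o => by cases o with
      | none => exact hmu.comap_le
      | some j => exact (hmS j).comap_le)
    -- The first index set consists of `none` and all `some k` with `k ∈ A`.
    (iIndep_option_comap hS hu) (S := {o | ∀ k, o = some k → k ∈ A}) (T := {some j})
    (Set.disjoint_singleton_right.2 fun h => hj (h j rfl))
  refine indep_of_indep_of_le key (sup_le ?_ (iSup₂_le fun k hk => ?_)) ?_
  · exact le_iSup₂_of_le none (by simp) le_rfl
  · exact le_iSup₂_of_le (some k) (by simpa using hk) le_rfl
  · exact le_iSup₂_of_le (some j) (by simp) le_rfl

theorem indepFun_of_measurable_history {u₀ : Ω → E} {S : J → Ω → Z} (hS : iIndepFun S μ)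
    (hu : IndepFun u₀ (fun ω j => S j ω) μ) (hmu : Measurable u₀) (hmS : ∀ j, Measurable (S j))
    {A : Set J} {j : J} (hj : j ∉ A) {F : Type*} [MeasurableSpace F] {X : Ω → F}
    (hX : Measurable[history u₀ S A] X) : IndepFun X (S j) μ :=
  (IndepFun_iff_Indep _ _ μ).2 <|
    indep_of_indep_of_le_left (indep_history hS hu hmu hmS hj) hX.comap_le

/-- If `Y` is independent of `X`, then the mean of a nonnegative `f (X, Y)` is at most the mean of
any bound `c X` of the means of `f (x, Y)`. -/
theorem integrable_and_integral_le_of_indepFun [IsProbabilityMeasure μ] {X : Ω → E} {Y : Ω → Z}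
    {ν : Measure Z} (hX : Measurable X) (hY : HasLaw Y ν μ) (hXY : IndepFun X Y μ)
    {f : E → Z → ℝ} (hf : Measurable (Function.uncurry f)) (h0 : ∀ x z, 0 ≤ f x z)
    (hint : ∀ x, Integrable (f x) ν) {c : E → ℝ} (hc : Measurable c)
    (hle : ∀ x, ∫ z, f x z ∂ν ≤ c x) (hcint : Integrable (fun ω => c (X ω)) μ) :
    Integrable (fun ω => f (X ω) (Y ω)) μ ∧ ∫ ω, f (X ω) (Y ω) ∂μ ≤ ∫ ω, c (X ω) ∂μ := by
  have hν : IsProbabilityMeasure ν := by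
    rw [← hY.map_eq]; exact Measure.isProbabilityMeasure_map hY.aemeasurable
  have hmap : μ.map (fun ω => (X ω, Y ω)) = (μ.map X).prod ν := by
    rw [(indepFun_iff_map_prod_eq_prod_map_map hX.aemeasurable hY.aemeasurable).1 hXY, hY.map_eq]
  have hXYm : AEMeasurable (fun ω => (X ω, Y ω)) μ := hX.aemeasurable.prodMk hY.aemeasurable
  have hcX : Integrable c (μ.map X) :=
    (integrable_map_measure hc.aestronglyMeasurable hX.aemeasurable).2 hcint
  have hmean : Integrable (fun x => ∫ z, f x z ∂ν) (μ.map X) := by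
    refine hcX.mono' hf.stronglyMeasurable.integral_prod_right.aestronglyMeasurable
      (Filter.Eventually.of_forall fun x => ?_)
    rw [Real.norm_of_nonneg (integral_nonneg (h0 x))]
    exact hle x
  have hprod : Integrable (Function.uncurry f) ((μ.map X).prod ν) := by
    have : IsProbabilityMeasure (μ.map X) := Measure.isProbabilityMeasure_map hX.aemeasurable
    -- Since `f` is nonnegative, the integrals of the norms over the sections are the means already
    -- known to be integrable.
    rw [integrable_prod_iff hf.aestronglyMeasurable]
    refine ⟨Filter.Eventually.of_forall hint, ?_⟩
    simpa [Function.uncurry, abs_of_nonneg (h0 _ _)] using hmean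
  have hprod' := hprod
  rw [← hmap] at hprod'
  refine ⟨(integrable_map_measure hf.aestronglyMeasurable hXYm).1 hprod', ?_⟩
  have : IsProbabilityMeasure (μ.map X) := Measure.isProbabilityMeasure_map hX.aemeasurable
  calc ∫ ω, f (X ω) (Y ω) ∂μ = ∫ p, Function.uncurry f p ∂(μ.map fun ω => (X ω, Y ω)) :=
        (integral_map hXYm hf.aestronglyMeasurable).symm
    _ = ∫ x, ∫ z, f x z ∂ν ∂(μ.map X) := by rw [hmap, integral_prod _ hprod]; rfl
    _ ≤ ∫ x, c x ∂(μ.map X) := integral_mono hmean hcX hle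
    _ = ∫ ω, c (X ω) ∂μ := integral_map hX.aemeasurable hc.aestronglyMeasurable

/-- If `Y` is independent of `X`, then the mean of `f (X, Y)` can be computed by first averaging
over `Y` for a fixed value of `X`. -/
theorem integral_eq_of_indepFun [IsProbabilityMeasure μ] {X : Ω → E} {Y : Ω → Z}
    {ν : Measure Z} (hX : Measurable X) (hY : HasLaw Y ν μ) (hXY : IndepFun X Y μ)
    {f : E → Z → ℝ} (hf : Measurable (Function.uncurry f))
    (hint : Integrable (fun ω => f (X ω) (Y ω)) μ) {c : E → ℝ} (hc : Measurable c)
    (hmean : ∀ x, ∫ z, f x z ∂ν = c x) :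
    ∫ ω, f (X ω) (Y ω) ∂μ = ∫ ω, c (X ω) ∂μ := by
  have hν : IsProbabilityMeasure ν := by
    rw [← hY.map_eq]; exact Measure.isProbabilityMeasure_map hY.aemeasurable
  have hmap : μ.map (fun ω => (X ω, Y ω)) = (μ.map X).prod ν := by
    rw [(indepFun_iff_map_prod_eq_prod_map_map hX.aemeasurable hY.aemeasurable).1 hXY, hY.map_eq]
  have hXYm : AEMeasurable (fun ω => (X ω, Y ω)) μ := hX.aemeasurable.prodMk hY.aemeasurable
  have hprod := (integrable_map_measure hf.aestronglyMeasurable hXYm).2 hint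
  rw [hmap] at hprod
  have : IsProbabilityMeasure (μ.map X) := Measure.isProbabilityMeasure_map hX.aemeasurable
  calc ∫ ω, f (X ω) (Y ω) ∂μ = ∫ p, Function.uncurry f p ∂(μ.map fun ω => (X ω, Y ω)) :=
        (integral_map hXYm hf.aestronglyMeasurable).symm
    _ = ∫ x, ∫ z, f x z ∂ν ∂(μ.map X) := by rw [hmap, integral_prod _ hprod]; rfl
    _ = ∫ x, c x ∂(μ.map X) := by simp_rw [hmean]
    _ = ∫ ω, c (X ω) ∂μ := integral_map hX.aemeasurable hc.aestronglyMeasurable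

end Independence

/-! ### First and second moments of the stochastic gradients and directions. -/

theorem integrable_sq_norm_of_memLp_two {Ω E : Type*} [MeasurableSpace Ω] {μ : Measure Ω}
    [NormedAddCommGroup E] {f : Ω → E} (hf : MemLp f 2 μ) :
    Integrable (fun ω => ‖f ω‖ ^ 2) μ :=
  (memLp_two_iff_integrable_sq_norm hf.1).1 hf

theorem integrable_inner_of_memLp_two {Ω E : Type*} [MeasurableSpace Ω] {μ : Measure Ω}
    [NormedAddCommGroup E] [InnerProductSpace ℝ E] {f g : Ω → E} (hf : MemLp f 2 μ)
    (hg : MemLp g 2 μ) : Integrable (fun ω => ⟪f ω, g ω⟫) μ :=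
  (hf.norm.integrable_mul hg.norm).mono' (hf.1.inner hg.1) <| Filter.Eventually.of_forall fun ω =>
    norm_inner_le_norm (f ω) (g ω)

theorem indepFun_comp_left {Ω E F Z : Type*} [MeasurableSpace Ω] [MeasurableSpace E]
    [MeasurableSpace F] [MeasurableSpace Z] {μ : Measure Ω} {X : Ω → E} {Y : Ω → Z}
    (h : IndepFun X Y μ) {φ : E → F} (hφ : Measurable φ) : IndepFun (fun ω => φ (X ω)) Y μ :=
  h.comp hφ measurable_id

/-- The mean of `‖f - c‖²` and the norm of `c` control the mean of `‖f‖²`. -/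
theorem integral_sq_norm_le_of_sub {Ω E : Type*} [MeasurableSpace Ω] {μ : Measure Ω}
    [IsProbabilityMeasure μ] [NormedAddCommGroup E] {f : Ω → E} (hf : MemLp f 2 μ) (c : E)
    {s b : ℝ} (hs : ∫ ω, ‖f ω - c‖ ^ 2 ∂μ ≤ s) (hb : ‖c‖ ≤ b) :
    ∫ ω, ‖f ω‖ ^ 2 ∂μ ≤ 2 * s + 2 * b ^ 2 := by
  have h1 : Integrable (fun ω => ‖f ω - c‖ ^ 2) μ :=
    integrable_sq_norm_of_memLp_two (hf.sub (memLp_const c))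
  calc ∫ ω, ‖f ω‖ ^ 2 ∂μ ≤ ∫ ω, (2 * ‖f ω - c‖ ^ 2 + 2 * b ^ 2) ∂μ := by
        refine integral_mono (integrable_sq_norm_of_memLp_two hf)
          ((h1.const_mul 2).add (integrable_const _)) fun ω => ?_
        have h2 := sq_norm_add_le_two_mul (f ω - c) c
        rw [sub_add_cancel] at h2
        refine h2.trans ?_
        gcongr
    _ = 2 * ∫ ω, ‖f ω - c‖ ^ 2 ∂μ + 2 * b ^ 2 := by
        rw [integral_add (h1.const_mul 2) (integrable_const _), integral_const_mul]
        simp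
    _ ≤ _ := by gcongr

/-- A bound of the second moment of a stochastic update direction. -/
noncomputable def directionBound (L σG σH G α : ℝ) : ℝ :=
  (2 + 2 * α ^ 2 * (2 * σH ^ 2 + 2 * L ^ 2)) * (2 * σG ^ 2 + 2 * G ^ 2)

theorem directionBound_nonneg (L σG σH G α : ℝ) : 0 ≤ directionBound L σG σH G α := by
  unfold directionBound; positivity

namespace Tasks

variable {n d : ℕ} {Z : Type*} [MeasurableSpace Z]

/-- The stochastic direction `(I - α ∇²ℓ_i(w; z₁)) ∇ℓ_i(u; z₂)`. -/
noncomputable def sampleDirection (P : Tasks n d Z) (α : ℝ) (i : Fin n) (w u : Model d)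
    (z₁ z₂ : Z) : Model d :=
  P.sampleGrad i u z₂ - α • P.sampleHess i w z₁ (P.sampleGrad i u z₂)

variable {P : Tasks n d Z} {L ρ σG σH G α : ℝ}

namespace Admissible

theorem continuous_riskGrad (h : P.Admissible L ρ σG σH G α) (i : Fin n) :
    Continuous (P.riskGrad i) :=
  (h.regular.differentiable_riskGrad i).continuous

theorem continuous_riskHess (h : P.Admissible L ρ σG σH G α) (i : Fin n) :
    Continuous (P.riskHess i) :=
  (LipschitzWith.of_dist_le' (K := ρ) fun x y => by
    simpa [dist_eq_norm] using (h.smooth i x y).2).continuous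

theorem continuous_adapt (h : P.Admissible L ρ σG σH G α) (i : Fin n) :
    Continuous (P.adapt α i) :=
  continuous_id.sub ((h.continuous_riskGrad i).const_smul α)

theorem continuous_metaGrad (h : P.Admissible L ρ σG σH G α) (i : Fin n) :
    Continuous fun p : Model d × Model d => P.metaGrad α i p.1 p.2 := by
  have h1 := (h.continuous_riskGrad i).comp (continuous_snd (X := Model d) (Y := Model d))
  have h2 := (h.continuous_riskHess i).comp (continuous_fst (X := Model d) (Y := Model d))
  exact h1.sub ((h2.clm_apply h1).const_smul α)

theorem measurable_sampleGrad_comp (h : P.Admissible L ρ σG σH G α) (i : Fin n) {T : Type*}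
    {_ : MeasurableSpace T} {w : T → Model d} {z : T → Z} (hw : Measurable w) (hz : Measurable z) :
    Measurable fun t => P.sampleGrad i (w t) (z t) :=
  (h.regular.measurable_sampleGrad i).comp (hw.prodMk hz)

theorem measurable_sampleHess_comp (h : P.Admissible L ρ σG σH G α) (i : Fin n) {T : Type*}
    {_ : MeasurableSpace T} {w : T → Model d} {z : T → Z} (hw : Measurable w) (hz : Measurable z) :
    Measurable fun t => P.sampleHess i (w t) (z t) :=
  (h.regular.measurable_sampleHess i).comp (hw.prodMk hz)

theorem measurable_riskGrad_comp (h : P.Admissible L ρ σG σH G α) (i : Fin n) {T : Type*}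
    {_ : MeasurableSpace T} {w : T → Model d} (hw : Measurable w) :
    Measurable fun t => P.riskGrad i (w t) :=
  (h.continuous_riskGrad i).measurable.comp hw

theorem measurable_sub_smul_sampleHess (h : P.Admissible L ρ σG σH G α) (i : Fin n) {T : Type*}
    {_ : MeasurableSpace T} {w x : T → Model d} {z : T → Z} (hw : Measurable w) (hz : Measurable z)
    (hx : Measurable x) : Measurable fun t => x t - α • P.sampleHess i (w t) (z t) (x t) := by
  have h1 : Measurable fun t => P.sampleHess i (w t) (z t) (x t) :=
    ContinuousLinearMap.measurable_apply₂.comp ((h.measurable_sampleHess_comp i hw hz).prodMk hx)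
  exact hx.sub (h1.const_smul α)

theorem measurable_sampleDirection (h : P.Admissible L ρ σG σH G α) (i : Fin n) {T : Type*}
    {_ : MeasurableSpace T} {w u : T → Model d} {z₁ z₂ : T → Z} (hw : Measurable w)
    (hu : Measurable u) (hz₁ : Measurable z₁) (hz₂ : Measurable z₂) :
    Measurable fun t => P.sampleDirection α i (w t) (u t) (z₁ t) (z₂ t) :=
  h.measurable_sub_smul_sampleHess i hw hz₁ (h.measurable_sampleGrad_comp i hu hz₂)

theorem integral_sq_norm_sampleGrad_le (h : P.Admissible L ρ σG σH G α) (i : Fin n)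
    (w : Model d) : ∫ z, ‖P.sampleGrad i w z‖ ^ 2 ∂(P.D i) ≤ 2 * σG ^ 2 + 2 * G ^ 2 :=
  have := P.prob i
  integral_sq_norm_le_of_sub (h.regular.memLp_sampleGrad i w) _ (h.variance i w).1 (h.bounded i w)

theorem integral_sq_norm_sampleHess_le (h : P.Admissible L ρ σG σH G α) (i : Fin n)
    (w : Model d) : ∫ z, ‖P.sampleHess i w z‖ ^ 2 ∂(P.D i) ≤ 2 * σH ^ 2 + 2 * L ^ 2 :=
  have := P.prob i
  integral_sq_norm_le_of_sub (h.regular.memLp_sampleHess i w) _ (h.variance i w).2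
    (h.norm_riskHess_le i w)

theorem norm_sampleDirection_le (h : P.Admissible L ρ σG σH G α) (i : Fin n) (w x : Model d)
    (z : Z) : ‖x - α • P.sampleHess i w z x‖ ≤ (1 + α * ‖P.sampleHess i w z‖) * ‖x‖ := by
  calc ‖x - α • P.sampleHess i w z x‖ ≤ ‖x‖ + ‖α • P.sampleHess i w z x‖ := norm_sub_le _ _
    _ = ‖x‖ + α * ‖P.sampleHess i w z x‖ := by rw [norm_smul, Real.norm_of_nonneg h.α_nonneg]
    _ ≤ ‖x‖ + α * (‖P.sampleHess i w z‖ * ‖x‖) := by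
        gcongr
        · exact h.α_nonneg
        · exact ContinuousLinearMap.le_opNorm _ _
    _ = _ := by ring

theorem memLp_one_add_norm_sampleHess (h : P.Admissible L ρ σG σH G α) (i : Fin n)
    (w : Model d) : MemLp (fun z => 1 + α * ‖P.sampleHess i w z‖) 2 (P.D i) := by
  have := P.prob i
  have h1 : MemLp (fun _ : Z => (1 : ℝ)) 2 (P.D i) := memLp_const 1
  have h2 : MemLp (fun z => α * ‖P.sampleHess i w z‖) 2 (P.D i) :=
    (h.regular.memLp_sampleHess i w).norm.const_mul α
  exact h1.add h2

theorem integral_sq_one_add_norm_sampleHess_le (h : P.Admissible L ρ σG σH G α) (i : Fin n)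
    (w : Model d) : ∫ z, (1 + α * ‖P.sampleHess i w z‖) ^ 2 ∂(P.D i)
      ≤ 2 + 2 * α ^ 2 * (2 * σH ^ 2 + 2 * L ^ 2) := by
  have := P.prob i
  have h1 := integrable_sq_norm_of_memLp_two (h.regular.memLp_sampleHess i w)
  calc ∫ z, (1 + α * ‖P.sampleHess i w z‖) ^ 2 ∂(P.D i)
      ≤ ∫ z, (2 + 2 * α ^ 2 * ‖P.sampleHess i w z‖ ^ 2) ∂(P.D i) := by
        refine integral_mono (h.memLp_one_add_norm_sampleHess i w).integrable_sq
          ((integrable_const _).add (h1.const_mul _)) fun z => ?_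
        show _ ≤ 2 + 2 * α ^ 2 * ‖P.sampleHess i w z‖ ^ 2
        nlinarith [sq_nonneg (1 - α * ‖P.sampleHess i w z‖)]
    _ = 2 + 2 * α ^ 2 * ∫ z, ‖P.sampleHess i w z‖ ^ 2 ∂(P.D i) := by
        rw [integral_add (integrable_const _) (h1.const_mul _), integral_const_mul]
        simp
    _ ≤ _ := by
        have := h.integral_sq_norm_sampleHess_le i w
        gcongr

section Random

variable {Ω : Type*} [MeasurableSpace Ω] {μ : Measure Ω} [IsProbabilityMeasure μ]

theorem integrable_and_integral_sq_one_add_norm_sampleHess_le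
    (h : P.Admissible L ρ σG σH G α) (i : Fin n)
    {w : Ω → Model d} {z₁ : Ω → Z} (hw : Measurable w) (hz₁ : HasLaw z₁ (P.D i) μ)
    (h₁ : IndepFun w z₁ μ) :
    Integrable (fun ω => (1 + α * ‖P.sampleHess i (w ω) (z₁ ω)‖) ^ 2) μ ∧
      ∫ ω, (1 + α * ‖P.sampleHess i (w ω) (z₁ ω)‖) ^ 2 ∂μ
        ≤ 2 + 2 * α ^ 2 * (2 * σH ^ 2 + 2 * L ^ 2) := by
  have key := integrable_and_integral_le_of_indepFun hw hz₁ h₁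
    (f := fun w z => (1 + α * ‖P.sampleHess i w z‖) ^ 2)
    (((h.regular.measurable_sampleHess i).norm.const_mul α).const_add 1 |>.pow_const 2)
    (fun _ _ => by positivity) (fun w => (h.memLp_one_add_norm_sampleHess i w).integrable_sq)
    measurable_const (h.integral_sq_one_add_norm_sampleHess_le i) (integrable_const _)
  simpa using key

/-- The Hessian and the gradient come from independent samples. Averaging over `z₂` with everything
else frozen, and then over `z₁`, bounds the second moment of the product by a product of second
moments; no fourth moments are needed. -/
theorem memLp_and_integral_sq_norm_sampleDirection_le
    (h : P.Admissible L ρ σG σH G α) (i : Fin n)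
    {w u : Ω → Model d} {z₁ z₂ : Ω → Z} (hw : Measurable w) (hu : Measurable u)
    (hz₁m : Measurable z₁) (hz₁ : HasLaw z₁ (P.D i) μ) (hz₂ : HasLaw z₂ (P.D i) μ)
    (h₁ : IndepFun w z₁ μ) (h₂ : IndepFun (fun ω => ((w ω, u ω), z₁ ω)) z₂ μ) :
    MemLp (fun ω => P.sampleDirection α i (w ω) (u ω) (z₁ ω) (z₂ ω)) 2 μ ∧
      ∫ ω, ‖P.sampleDirection α i (w ω) (u ω) (z₁ ω) (z₂ ω)‖ ^ 2 ∂μ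
        ≤ directionBound L σG σH G α := by
  obtain ⟨hi, hb⟩ := h.integrable_and_integral_sq_one_add_norm_sampleHess_le i hw hz₁ h₁
  have hm : Measurable fun p : ((Model d × Model d) × Z) × Z =>
      P.sampleDirection α i p.1.1.1 p.1.1.2 p.1.2 p.2 :=
    h.measurable_sampleDirection i (by fun_prop) (by fun_prop) (by fun_prop) (by fun_prop)
  have key := integrable_and_integral_le_of_indepFun ((hw.prodMk hu).prodMk hz₁m) hz₂ h₂
    (f := fun x z => ‖P.sampleDirection α i x.1.1 x.1.2 x.2 z‖ ^ 2)
    (c := fun x => (1 + α * ‖P.sampleHess i x.1.1 x.2‖) ^ 2 * (2 * σG ^ 2 + 2 * G ^ 2))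
    (hm.norm.pow_const 2) (fun _ _ => by positivity)
    (fun x => integrable_sq_norm_of_memLp_two <|
      (ContinuousLinearMap.id ℝ _ - α • P.sampleHess i x.1.1 x.2).comp_memLp'
        (h.regular.memLp_sampleGrad i x.1.2))
    (by
      have : Measurable fun x : (Model d × Model d) × Z => P.sampleHess i x.1.1 x.2 :=
        h.measurable_sampleHess_comp i (by fun_prop) (by fun_prop)
      exact ((this.norm.const_mul α).const_add 1 |>.pow_const 2).mul_const _)
    (fun x => by
      calc ∫ z, ‖P.sampleDirection α i x.1.1 x.1.2 x.2 z‖ ^ 2 ∂(P.D i)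
          ≤ ∫ z, (1 + α * ‖P.sampleHess i x.1.1 x.2‖) ^ 2 * ‖P.sampleGrad i x.1.2 z‖ ^ 2
              ∂(P.D i) := by
            refine integral_mono (integrable_sq_norm_of_memLp_two <|
              (ContinuousLinearMap.id ℝ _ - α • P.sampleHess i x.1.1 x.2).comp_memLp'
                (h.regular.memLp_sampleGrad i x.1.2))
              ((integrable_sq_norm_of_memLp_two
                (h.regular.memLp_sampleGrad i x.1.2)).const_mul _) fun z => ?_
            have := h.norm_sampleDirection_le i x.1.1 (P.sampleGrad i x.1.2 z) x.2
            show ‖P.sampleGrad i x.1.2 z - α • P.sampleHess i x.1.1 x.2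
              (P.sampleGrad i x.1.2 z)‖ ^ 2 ≤ _
            rw [← mul_pow]
            gcongr
        _ ≤ _ := by
            rw [integral_const_mul]
            have := h.integral_sq_norm_sampleGrad_le i x.1.2
            gcongr)
    (hi.mul_const _)
  constructor
  · rw [memLp_two_iff_integrable_sq_norm]
    · exact key.1
    · exact (hm.comp_aemeasurable (((hw.prodMk hu).prodMk hz₁m).aemeasurable.prodMk
        hz₂.aemeasurable)).aestronglyMeasurable
  · refine key.2.trans ?_
    rw [integral_mul_const]
    unfold directionBound
    gcongr

/-- The tower property in two stages: the gradient sample is averaged out for a frozen Hessian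
sample, and then the Hessian sample. The linearity of the direction in each of the two factors makes
both stages exact. -/
theorem integral_inner_sampleDirection (h : P.Admissible L ρ σG σH G α) (i : Fin n)
    {y w u : Ω → Model d} {z₁ z₂ : Ω → Z} (hy : Measurable y) {b : ℝ} (hb : ∀ ω, ‖y ω‖ ≤ b)
    (hw : Measurable w) (hu : Measurable u)
    (hz₁m : Measurable z₁) (hz₁ : HasLaw z₁ (P.D i) μ) (hz₂ : HasLaw z₂ (P.D i) μ)
    (h₁ : IndepFun (fun ω => (y ω, w ω, u ω)) z₁ μ)
    (h₂ : IndepFun (fun ω => (y ω, (w ω, u ω), z₁ ω)) z₂ μ) :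
    ∫ ω, ⟪y ω, P.sampleDirection α i (w ω) (u ω) (z₁ ω) (z₂ ω)⟫ ∂μ
      = ∫ ω, ⟪y ω, P.metaGrad α i (w ω) (u ω)⟫ ∂μ := by
  have := P.prob i
  have h₁' : IndepFun w z₁ μ := 
    indepFun_comp_left (φ := fun p => p.2.1) h₁ (measurable_fst.comp measurable_snd)
  obtain ⟨hL2, -⟩ := h.memLp_and_integral_sq_norm_sampleDirection_le i hw hu hz₁m hz₁ hz₂ h₁'
    (indepFun_comp_left (φ := Prod.snd) h₂ measurable_snd)
  obtain ⟨hi, -⟩ := h.integrable_and_integral_sq_one_add_norm_sampleHess_le i hw hz₁ h₁'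
  have hyL2 : MemLp y 2 μ :=
    MemLp.of_bound hy.aestronglyMeasurable b (Filter.Eventually.of_forall hb)
  have hmid : Measurable fun x : Model d × (Model d × Model d) × Z =>
      P.riskGrad i x.2.1.2 - α • P.sampleHess i x.2.1.1 x.2.2 (P.riskGrad i x.2.1.2) :=
    h.measurable_sub_smul_sampleHess i (by fun_prop) (by fun_prop)
      (h.measurable_riskGrad_comp i (by fun_prop))
  have hmid' : Measurable fun ω => P.riskGrad i (u ω)
      - α • P.sampleHess i (w ω) (z₁ ω) (P.riskGrad i (u ω)) :=
    h.measurable_sub_smul_sampleHess i hw hz₁m (h.measurable_riskGrad_comp i hu)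
  -- The intermediate direction, with the exact gradient but a stochastic Hessian, is not bounded;
  -- it is square-integrable because `G` bounds the gradient.
  have hmid2 : MemLp (fun ω => P.riskGrad i (u ω)
      - α • P.sampleHess i (w ω) (z₁ ω) (P.riskGrad i (u ω))) 2 μ := by
    have hi' : MemLp (fun ω => 1 + α * ‖P.sampleHess i (w ω) (z₁ ω)‖) 2 μ := by
      refine (memLp_two_iff_integrable_sq ?_).2 hi
      have h3 := h.measurable_sampleHess_comp i hw hz₁m
      exact (Measurable.const_add (h3.norm.const_mul α) 1).aestronglyMeasurable
    have hi'' : MemLp (fun ω => (1 + α * ‖P.sampleHess i (w ω) (z₁ ω)‖) * G) 2 μ :=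
      hi'.mul_const G
    refine hi''.mono' hmid'.aestronglyMeasurable (Filter.Eventually.of_forall fun ω => ?_)
    refine (h.norm_sampleDirection_le i (w ω) _ _).trans ?_
    have := h.α_nonneg
    gcongr
    exact h.bounded i _
  have step₂ : ∫ ω, ⟪y ω, P.sampleDirection α i (w ω) (u ω) (z₁ ω) (z₂ ω)⟫ ∂μ
      = ∫ ω, ⟪y ω, P.riskGrad i (u ω)
        - α • P.sampleHess i (w ω) (z₁ ω) (P.riskGrad i (u ω))⟫ ∂μ := by
    refine integral_eq_of_indepFun (hy.prodMk ((hw.prodMk hu).prodMk hz₁m)) hz₂ h₂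
      (f := fun x z => ⟪x.1, P.sampleDirection α i x.2.1.1 x.2.1.2 x.2.2 z⟫)
      (c := fun x => ⟪x.1, P.riskGrad i x.2.1.2
        - α • P.sampleHess i x.2.1.1 x.2.2 (P.riskGrad i x.2.1.2)⟫) ?_ ?_ ?_ ?_
    · have h3 : Measurable fun p : (Model d × (Model d × Model d) × Z) × Z =>
          P.sampleDirection α i p.1.2.1.1 p.1.2.1.2 p.1.2.2 p.2 :=
        h.measurable_sampleDirection i (by fun_prop) (by fun_prop) (by fun_prop) (by fun_prop)
      exact (measurable_fst.comp measurable_fst).inner h3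
    · exact integrable_inner_of_memLp_two hyL2 hL2
    · exact measurable_fst.inner hmid
    · intro x
      have hg : Integrable (P.sampleGrad i x.2.1.2) (P.D i) :=
        (h.regular.memLp_sampleGrad i x.2.1.2).integrable (by norm_num)
      set A := ContinuousLinearMap.id ℝ _ - α • P.sampleHess i x.2.1.1 x.2.2
      change ∫ z, ⟪x.1, A (P.sampleGrad i x.2.1.2 z)⟫ ∂(P.D i) = ⟪x.1, A (P.riskGrad i x.2.1.2)⟫
      rw [integral_inner (A.integrable_comp hg), A.integral_comp_comm hg, h.regular.unbiased_grad]
  have step₁ : ∫ ω, ⟪y ω, P.riskGrad i (u ω)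
        - α • P.sampleHess i (w ω) (z₁ ω) (P.riskGrad i (u ω))⟫ ∂μ
      = ∫ ω, ⟪y ω, P.metaGrad α i (w ω) (u ω)⟫ ∂μ := by
    refine integral_eq_of_indepFun (hy.prodMk (hw.prodMk hu)) hz₁ h₁
      (f := fun x z => ⟪x.1, P.riskGrad i x.2.2
        - α • P.sampleHess i x.2.1 z (P.riskGrad i x.2.2)⟫)
      (c := fun x => ⟪x.1, P.metaGrad α i x.2.1 x.2.2⟫) ?_ ?_ ?_ ?_
    · have h3 : Measurable fun p : (Model d × Model d × Model d) × Z =>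
          P.riskGrad i p.1.2.2 - α • P.sampleHess i p.1.2.1 p.2 (P.riskGrad i p.1.2.2) :=
        h.measurable_sub_smul_sampleHess i (by fun_prop) (by fun_prop)
          (h.measurable_riskGrad_comp i (by fun_prop))
      exact (measurable_fst.comp measurable_fst).inner h3
    · exact integrable_inner_of_memLp_two hyL2 hmid2
    · have h3 : Measurable fun x : Model d × Model d × Model d => P.metaGrad α i x.2.1 x.2.2 :=
        (h.continuous_metaGrad i).measurable.comp measurable_snd
      exact measurable_fst.inner h3
    · intro x
      have hg : Integrable (P.sampleHess i x.2.1) (P.D i) :=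
        (h.regular.memLp_sampleHess i x.2.1).integrable (by norm_num)
      have hg' : Integrable (fun z => P.sampleHess i x.2.1 z (P.riskGrad i x.2.2)) (P.D i) :=
        hg.apply_continuousLinearMap _
      have hg'' : Integrable (fun z => P.riskGrad i x.2.2
          - α • P.sampleHess i x.2.1 z (P.riskGrad i x.2.2)) (P.D i) :=
        (integrable_const _).sub (hg'.smul α)
      have hg₃ : Integrable (fun z => α • P.sampleHess i x.2.1 z (P.riskGrad i x.2.2)) (P.D i) :=
        hg'.smul α
      rw [integral_inner hg'', integral_sub (integrable_const _) hg₃, integral_smul]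
      simp only [integral_const, probReal_univ, one_smul]
      rw [← ContinuousLinearMap.integral_apply hg, h.regular.unbiased_hess, metaGrad]
  exact step₂.trans step₁

theorem memLp_and_integral_sq_norm_sampleGrad_sub_le (h : P.Admissible L ρ σG σH G α) (i : Fin n)
    {w : Ω → Model d} {z₀ : Ω → Z} (hw : Measurable w) (hz₀ : HasLaw z₀ (P.D i) μ)
    (h₀ : IndepFun w z₀ μ) :
    MemLp (fun ω => P.sampleGrad i (w ω) (z₀ ω) - P.riskGrad i (w ω)) 2 μ ∧
      ∫ ω, ‖P.sampleGrad i (w ω) (z₀ ω) - P.riskGrad i (w ω)‖ ^ 2 ∂μ ≤ σG ^ 2 := by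
  have := P.prob i
  have hm : Measurable fun p : Model d × Z => P.sampleGrad i p.1 p.2 - P.riskGrad i p.1 :=
    (h.regular.measurable_sampleGrad i).sub
      ((h.continuous_riskGrad i).measurable.comp measurable_fst)
  have key := integrable_and_integral_le_of_indepFun hw hz₀ h₀
    (f := fun w z => ‖P.sampleGrad i w z - P.riskGrad i w‖ ^ 2)
    (hm.norm.pow_const 2) (fun _ _ => by positivity)
    (fun w => integrable_sq_norm_of_memLp_two
      ((h.regular.memLp_sampleGrad i w).sub (memLp_const _)))
    measurable_const (fun w => (h.variance i w).1) (integrable_const _)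
  refine ⟨?_, by simpa using key.2⟩
  rw [memLp_two_iff_integrable_sq_norm]
  · exact key.1
  · exact (hm.comp_aemeasurable (hw.aemeasurable.prodMk hz₀.aemeasurable)).aestronglyMeasurable

/-- The sampling error is orthogonal to everything independent of the sample. This removes the cross
term in the lag recursion. -/
theorem integral_inner_sampleGrad_sub (h : P.Admissible L ρ σG σH G α) (i : Fin n)
    {x w : Ω → Model d} {z₀ : Ω → Z} (hx : Measurable x) (hxL2 : MemLp x 2 μ) (hw : Measurable w)
    (hz₀ : HasLaw z₀ (P.D i) μ) (h₀ : IndepFun (fun ω => (x ω, w ω)) z₀ μ) :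
    ∫ ω, ⟪x ω, P.sampleGrad i (w ω) (z₀ ω) - P.riskGrad i (w ω)⟫ ∂μ = 0 := by
  have := P.prob i
  obtain ⟨hL2, -⟩ := h.memLp_and_integral_sq_norm_sampleGrad_sub_le i hw hz₀
    (indepFun_comp_left (φ := Prod.snd) h₀ measurable_snd)
  have hm' : Measurable fun p : (Model d × Model d) × Z =>
      P.sampleGrad i p.1.2 p.2 - P.riskGrad i p.1.2 :=
    (h.measurable_sampleGrad_comp i (by fun_prop) (by fun_prop)).sub
      (h.measurable_riskGrad_comp i (by fun_prop))
  have key : ∫ ω, ⟪x ω, P.sampleGrad i (w ω) (z₀ ω) - P.riskGrad i (w ω)⟫ ∂μ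
      = ∫ _ω, (0 : ℝ) ∂μ := by
    refine integral_eq_of_indepFun (hx.prodMk hw) hz₀ h₀
      (f := fun x z => ⟪x.1, P.sampleGrad i x.2 z - P.riskGrad i x.2⟫) (c := fun _ => 0)
      ((measurable_fst.comp measurable_fst).inner hm')
      (integrable_inner_of_memLp_two hxL2 hL2) measurable_const fun x => ?_
    have hg : Integrable (P.sampleGrad i x.2) (P.D i) :=
      (h.regular.memLp_sampleGrad i x.2).integrable (by norm_num)
    have hg' : Integrable (fun z => P.sampleGrad i x.2 z - P.riskGrad i x.2) (P.D i) :=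
      hg.sub (integrable_const _)
    rw [integral_inner hg', integral_sub hg (integrable_const _),
      h.regular.unbiased_grad]
    simp
  simpa using key

end Random

end Admissible

end Tasks

/-! ### Second moments of averages. -/

section Average

variable {Ω E : Type*} [MeasurableSpace Ω] {μ : Measure Ω} [NormedAddCommGroup E]
  [NormedSpace ℝ E]

theorem memLp_average {m : ℕ} {f : Fin m → Ω → E} (hf : ∀ k, MemLp (f k) 2 μ) :
    MemLp (fun ω => (m : ℝ)⁻¹ • ∑ k, f k ω) 2 μ :=
  (memLp_finsetSum Finset.univ fun k _ => hf k).const_smul (m : ℝ)⁻¹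

theorem integral_sq_norm_average_le {m : ℕ} (hm : 0 < m) {f : Fin m → Ω → E}
    (hf : ∀ k, MemLp (f k) 2 μ) :
    ∫ ω, ‖(m : ℝ)⁻¹ • ∑ k, f k ω‖ ^ 2 ∂μ ≤ (m : ℝ)⁻¹ * ∑ k, ∫ ω, ‖f k ω‖ ^ 2 ∂μ := by
  have hi : ∀ k, Integrable (fun ω => ‖f k ω‖ ^ 2) μ := fun k =>
    integrable_sq_norm_of_memLp_two (hf k)
  rw [← integral_finsetSum _ fun k _ => hi k, ← integral_const_mul]
  exact integral_mono (integrable_sq_norm_of_memLp_two (memLp_average hf))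
    ((integrable_finsetSum _ fun k _ => hi k).const_mul _) fun ω =>
      sq_norm_average_fin_le hm fun k => f k ω

theorem measurable_average {T : Type*} {_ : MeasurableSpace T} {d m : ℕ} {f : Fin m → T → Model d}
    (hf : ∀ k, Measurable (f k)) : Measurable fun ω => (m : ℝ)⁻¹ • ∑ k, f k ω := by
  have h : Measurable fun ω => ∑ k, f k ω := Finset.measurable_fun_sum _ fun k _ => hf k
  exact h.const_smul (m : ℝ)⁻¹

theorem average_le {m : ℕ} (hm : 0 < m) {x : Fin m → ℝ} {c : ℝ} (hx : ∀ k, x k ≤ c) :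
    (m : ℝ)⁻¹ * ∑ k, x k ≤ c := by
  have : (0 : ℝ) < m := by exact_mod_cast hm
  rw [inv_mul_le_iff₀ this]
  simpa using Finset.sum_le_sum fun k (_ : k ∈ Finset.univ) => hx k

theorem integral_sq_norm_average_le_of_le {m : ℕ} (hm : 0 < m) {f : Fin m → Ω → E}
    (hf : ∀ k, MemLp (f k) 2 μ) {c : ℝ} (hc : ∀ k, ∫ ω, ‖f k ω‖ ^ 2 ∂μ ≤ c) :
    ∫ ω, ‖(m : ℝ)⁻¹ • ∑ k, f k ω‖ ^ 2 ∂μ ≤ c :=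
  (integral_sq_norm_average_le hm hf).trans (average_le hm hc)

end Average

/-! ### The random process: recursions, histories and measurability. -/

/-- All the data of a run of LocalMOML: tasks, parameters, initial models and samples. -/
structure Experiment (n d K : ℕ) (Z Ω : Type*) [MeasurableSpace Z] [MeasurableSpace Ω] where
  P : Tasks n d Z
  α : ℝ
  β : ℝ
  η : ℝ
  H : ℕ
  w₁ : Model d
  u₀ : Fin n → Ω → Model d
  S : SampleIndex n K → Ω → Z
  μ : Measure Ω

namespace Experiment

variable {n d K : ℕ} {Z Ω : Type*} [MeasurableSpace Z] [MeasurableSpace Ω]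
  (X : Experiment n d K Z Ω)

/-- The state of the system after `r` rounds. -/
noncomputable def server (r : ℕ) (ω : Ω) : SystemState n d :=
  localMOML X.P X.α X.β X.η X.H X.w₁ (fun i => X.u₀ i ω) (fun j => X.S j ω) r

/-- The state of client `i` after `h` local iterations in round `r`. -/
noncomputable def client (r : ℕ) (i : Fin n) (h : ℕ) (ω : Ω) : ClientState d :=
  localSteps X.P X.α X.β X.η i (fun h b k => X.S (i, r, h, b, k) ω)
    { u := (X.server r ω).u i, w := (X.server r ω).w,
      iterations := (X.server r ω).iterations i, samples := (X.server r ω).samples i } h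

/-- The meta-model at the beginning of round `r`. -/
noncomputable def glob (r : ℕ) (ω : Ω) : Model d := (X.server r ω).w

/-- The local copy of the meta-model of client `i` after `h` local iterations in round `r`. -/
noncomputable def loc (r : ℕ) (i : Fin n) (h : ℕ) (ω : Ω) : Model d := (X.client r i h ω).w

/-- The personalized model of client `i` after `h` local iterations in round `r`. -/
noncomputable def pers (r : ℕ) (i : Fin n) (h : ℕ) (ω : Ω) : Model d := (X.client r i h ω).u

/-- The stochastic direction of client `i` in local iteration `h` of round `r`. -/
noncomputable def step (r : ℕ) (i : Fin n) (h : ℕ) (ω : Ω) : Model d :=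
  (K : ℝ)⁻¹ • ∑ k, (K : ℝ)⁻¹ • ∑ k', X.P.sampleDirection X.α i (X.loc r i h ω)
    (X.pers r i (h + 1) ω) (X.S (i, r, h, 1, k) ω) (X.S (i, r, h, 2, k') ω)

theorem glob_zero (ω : Ω) : X.glob 0 ω = X.w₁ := rfl

theorem loc_zero (r : ℕ) (i : Fin n) (ω : Ω) : X.loc r i 0 ω = X.glob r ω := rfl

theorem pers_succ_zero (r : ℕ) (i : Fin n) (ω : Ω) :
    X.pers (r + 1) i 0 ω = X.pers r i X.H ω := rfl

theorem pers_succ (r : ℕ) (i : Fin n) (h : ℕ) (ω : Ω) :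
    X.pers r i (h + 1) ω = (1 - X.β) • X.pers r i h ω
      + X.β • (X.loc r i h ω - X.α • X.P.batchGrad i (fun k => X.S (i, r, h, 0, k) ω)
        (X.loc r i h ω)) := rfl

/-- The batch Hessian applied to the batch gradient is bilinear in the two averages, so the update
is a double average of single-sample directions over all pairs of samples. The identity part does
not depend on the Hessian sample; averaging it requires `K > 0`. -/
theorem loc_succ (hK : 0 < K) (r : ℕ) (i : Fin n) (h : ℕ) (ω : Ω) :
    X.loc r i (h + 1) ω = X.loc r i h ω - X.η • X.step r i h ω := by
  have h1 : X.loc r i (h + 1) ω = X.loc r i h ω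
      - X.η • (X.P.batchGrad i (fun k => X.S (i, r, h, 2, k) ω) (X.pers r i (h + 1) ω)
        - X.α • X.P.batchHess i (fun k => X.S (i, r, h, 1, k) ω) (X.loc r i h ω)
          (X.P.batchGrad i (fun k => X.S (i, r, h, 2, k) ω) (X.pers r i (h + 1) ω))) := rfl
  have h2 : ∀ k : Fin K, (K : ℝ)⁻¹ • ∑ k', X.P.sampleDirection X.α i (X.loc r i h ω)
      (X.pers r i (h + 1) ω) (X.S (i, r, h, 1, k) ω) (X.S (i, r, h, 2, k') ω)
      = X.P.batchGrad i (fun k => X.S (i, r, h, 2, k) ω) (X.pers r i (h + 1) ω)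
        - X.α • X.P.sampleHess i (X.loc r i h ω) (X.S (i, r, h, 1, k) ω)
          (X.P.batchGrad i (fun k => X.S (i, r, h, 2, k) ω) (X.pers r i (h + 1) ω)) := by
    intro k
    simp only [Tasks.sampleDirection, Tasks.batchGrad, Finset.sum_sub_distrib, smul_sub, map_smul,
      map_sum, Finset.smul_sum, smul_comm (K : ℝ)⁻¹ X.α]
  rw [h1, step]
  simp only [h2]
  rw [Finset.sum_sub_distrib, smul_sub (K : ℝ)⁻¹, average_fin_const hK]
  simp only [Tasks.batchHess, smul_apply, sum_apply, ← Finset.smul_sum,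
    smul_comm (K : ℝ)⁻¹ X.α]

/-- The samples drawn before the batch `b` of local iteration `h` of round `r`. -/
def past (n K r h b : ℕ) : Set (SampleIndex n K) :=
  {j | j.2.1 < r ∨ j.2.1 = r ∧ (j.2.2.1 < h ∨ j.2.2.1 = h ∧ (j.2.2.2.1 : ℕ) < b)}

/-- The `σ`-algebra of the initial models and the samples drawn before the batch `b` of local
iteration `h` of round `r`. -/
@[reducible] def hist (r h b : ℕ) : MeasurableSpace Ω :=
  history (fun ω i => X.u₀ i ω) X.S (past n K r h b)

/-- The assumptions on a run. -/
structure Valid (L ρ σG σH G : ℝ) : Prop where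
  adm : X.P.Admissible L ρ σG σH G X.α
  K_pos : 0 < K
  prob : IsProbabilityMeasure X.μ
  β_pos : 0 < X.β
  β_le : X.β ≤ 1
  η_nonneg : 0 ≤ X.η
  meas_S : ∀ j, Measurable (X.S j)
  meas_u₀ : ∀ i, Measurable (X.u₀ i)
  run : RunData X.μ X.P K X.S X.u₀

theorem hist_mono {r h b r' h' b' : ℕ} (hr : r < r' ∨ r = r' ∧ (h < h' ∨ h = h' ∧ b ≤ b')) :
    X.hist r h b ≤ X.hist r' h' b' := by
  refine history_mono _ _ fun j hj => ?_
  simp only [past, Set.mem_ofPred_eq] at hj ⊢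
  omega

theorem hist_round_le (r h b : ℕ) : X.hist r h b ≤ X.hist (r + 1) 0 0 :=
  X.hist_mono (Or.inl (Nat.lt_succ_self r))

theorem hist_iteration_le (r h b : ℕ) : X.hist r h b ≤ X.hist r (h + 1) 0 :=
  X.hist_mono (Or.inr ⟨rfl, Or.inl (Nat.lt_succ_self h)⟩)

theorem hist_batch_le (r h : ℕ) {b b' : ℕ} (hb : b ≤ b') : X.hist r h b ≤ X.hist r h b' :=
  X.hist_mono (Or.inr ⟨rfl, Or.inr ⟨rfl, hb⟩⟩)

theorem measurable_sample (i : Fin n) (r h : ℕ) (b : Fin 3) (k : Fin K) {b' : ℕ}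
    (hb : (b : ℕ) < b') : Measurable[X.hist r h b'] (X.S (i, r, h, b, k)) :=
  measurable_history_sample _ _ (by simp [past, hb])

variable {X} {L ρ σG σH G : ℝ}

theorem Valid.hist_le (V : X.Valid L ρ σG σH G) (r h b : ℕ) :
    X.hist r h b ≤ ‹MeasurableSpace Ω› :=
  history_le (measurable_pi_lambda _ V.meas_u₀) V.meas_S _

theorem Valid.indepFun_sample (V : X.Valid L ρ σG σH G) (i : Fin n) (r h : ℕ) (b : Fin 3)
    (k : Fin K) {b' : ℕ} (hb : b' ≤ b) {F : Type*} [MeasurableSpace F] {Y : Ω → F}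
    (hY : Measurable[X.hist r h b'] Y) : IndepFun Y (X.S (i, r, h, b, k)) X.μ :=
  indepFun_of_measurable_history V.run.indep V.run.indep_init (measurable_pi_lambda _ V.meas_u₀)
    V.meas_S (by simp [past, hb]) hY

theorem Valid.measurable_pers_succ_of (V : X.Valid L ρ σG σH G) {r h : ℕ} {i : Fin n}
    (hl : Measurable[X.hist r h 0] (X.loc r i h)) (hp : Measurable[X.hist r h 0] (X.pers r i h)) :
    Measurable[X.hist r h 1] (X.pers r i (h + 1)) := by
  have h01 := X.hist_batch_le r h (Nat.zero_le 1)
  have hl' := hl.mono h01 le_rfl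
  have hp' := hp.mono h01 le_rfl
  have hg : Measurable[X.hist r h 1] fun ω =>
      X.P.batchGrad i (fun k => X.S (i, r, h, 0, k) ω) (X.loc r i h ω) := by
    unfold Tasks.batchGrad
    refine measurable_average fun k => ?_
    exact V.adm.measurable_sampleGrad_comp i hl' (X.measurable_sample i r h 0 k (by simp))
  exact (hp'.const_smul (1 - X.β)).add ((hl'.sub (hg.const_smul X.α)).const_smul X.β)

theorem Valid.measurable_loc_succ_of (V : X.Valid L ρ σG σH G) {r h : ℕ} {i : Fin n}
    (hl : Measurable[X.hist r h 0] (X.loc r i h))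
    (hp : Measurable[X.hist r h 1] (X.pers r i (h + 1))) :
    Measurable[X.hist r (h + 1) 0] (X.loc r i (h + 1)) := by
  have hl' := hl.mono (X.hist_iteration_le r h 0) le_rfl
  have hp' := hp.mono (X.hist_iteration_le r h 1) le_rfl
  have hs : Measurable[X.hist r (h + 1) 0] (X.step r i h) := by
    unfold step
    refine measurable_average fun k => measurable_average fun k' => ?_
    exact V.adm.measurable_sampleDirection i hl' hp'
      ((X.measurable_sample i r h 1 k (b' := 3) (by simp)).mono (X.hist_iteration_le r h 3) le_rfl)
      ((X.measurable_sample i r h 2 k' (b' := 3) (by simp)).mono (X.hist_iteration_le r h 3) le_rfl)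
  have e : X.loc r i (h + 1) = fun ω => X.loc r i h ω - X.η • X.step r i h ω :=
    funext fun ω => X.loc_succ V.K_pos r i h ω
  rw [e]
  exact hl'.sub (hs.const_smul X.η)

theorem Valid.measurable_client_of (V : X.Valid L ρ σG σH G) {r : ℕ}
    (hm : Measurable[X.hist r 0 0] (X.glob r))
    (hp : ∀ i, Measurable[X.hist r 0 0] (X.pers r i 0)) (i : Fin n) (h : ℕ) :
    Measurable[X.hist r h 0] (X.loc r i h) ∧ Measurable[X.hist r h 0] (X.pers r i h) := by
  induction h with
  | zero => exact ⟨hm, hp i⟩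
  | succ h ih =>
    have hp' := V.measurable_pers_succ_of ih.1 ih.2
    exact ⟨V.measurable_loc_succ_of ih.1 hp', hp'.mono (X.hist_iteration_le r h 1) le_rfl⟩

theorem Valid.measurable_round (V : X.Valid L ρ σG σH G) (r : ℕ) :
    Measurable[X.hist r 0 0] (X.glob r) ∧ ∀ i, Measurable[X.hist r 0 0] (X.pers r i 0) := by
  induction r with
  | zero =>
    refine ⟨measurable_const, fun i => ?_⟩
    have h1 : Measurable[X.hist 0 0 0] fun ω i => X.u₀ i ω := measurable_history_init _ _ _
    exact (measurable_pi_apply i).comp h1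
  | succ r ih =>
    have hc := V.measurable_client_of ih.1 ih.2
    constructor
    · exact measurable_average fun i => (hc i X.H).1.mono (X.hist_round_le r X.H 0) le_rfl
    · exact fun i => (hc i X.H).2.mono (X.hist_round_le r X.H 0) le_rfl

theorem Valid.measurable_loc (V : X.Valid L ρ σG σH G) (r : ℕ) (i : Fin n) (h : ℕ) :
    Measurable[X.hist r h 0] (X.loc r i h) :=
  (V.measurable_client_of (V.measurable_round r).1 (V.measurable_round r).2 i h).1

theorem Valid.measurable_pers (V : X.Valid L ρ σG σH G) (r : ℕ) (i : Fin n) (h : ℕ) :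
    Measurable[X.hist r h 0] (X.pers r i h) :=
  (V.measurable_client_of (V.measurable_round r).1 (V.measurable_round r).2 i h).2

/-- The new personalized model uses only batch `0`. It is thus known before batches `1` and `2`,
which estimate the direction at it. -/
theorem Valid.measurable_pers_succ (V : X.Valid L ρ σG σH G) (r : ℕ) (i : Fin n) (h : ℕ) :
    Measurable[X.hist r h 1] (X.pers r i (h + 1)) :=
  V.measurable_pers_succ_of (V.measurable_loc r i h) (V.measurable_pers r i h)

end Experiment

/-! ### Unbiased steps and the drift of the local models. -/

namespace Experiment

variable {n d K : ℕ} {Z Ω : Type*} [MeasurableSpace Z] [MeasurableSpace Ω]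

section Definitions

variable (X : Experiment n d K Z Ω)

/-- The distance of the personalized model of a client from the exact adaptation of its local
model. -/
noncomputable def lag (r : ℕ) (i : Fin n) (h : ℕ) (ω : Ω) : Model d :=
  X.pers r i h ω - X.P.adapt X.α i (X.loc r i h ω)

/-- The distance of the updated personalized model from the exact adaptation of the local model
used in the update. -/
noncomputable def freshLag (r : ℕ) (i : Fin n) (h : ℕ) (ω : Ω) : Model d :=
  X.pers r i (h + 1) ω - X.P.adapt X.α i (X.loc r i h ω)

/-- The average of the local models of all clients. -/
noncomputable def virtual (r h : ℕ) (ω : Ω) : Model d := (n : ℝ)⁻¹ • ∑ i, X.loc r i h ω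

/-- A bound of the mean squared distance of the local models from the meta-model. -/
noncomputable def driftBound (L σG σH G : ℝ) : ℝ :=
  (X.H * X.η) ^ 2 * directionBound L σG σH G X.α

/-- The stationary bound of the mean squared lag. -/
noncomputable def lagBound (L σG σH G : ℝ) : ℝ :=
  2 * X.β * (X.α * σG) ^ 2
    + 2 * adaptLip L X.α ^ 2 * directionBound L σG σH G X.α * (X.η ^ 2 / X.β ^ 2)

/-- The mean squared lag at the beginning of round `r`, averaged over the clients. -/
noncomputable def meanLag (r : ℕ) : ℝ := (n : ℝ)⁻¹ * ∑ i, ∫ ω, ‖X.lag r i 0 ω‖ ^ 2 ∂X.μ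

/-- The expected meta-objective at the average of the local models. -/
noncomputable def meanObjective (r h : ℕ) : ℝ :=
  ∫ ω, X.P.metaObjective X.α (X.virtual r h ω) ∂X.μ

/-- The expected squared norm of the gradient of the meta-objective at the average of the local
models. -/
noncomputable def meanSqGrad (r h : ℕ) : ℝ :=
  ∫ ω, ‖gradient (X.P.metaObjective X.α) (X.virtual r h ω)‖ ^ 2 ∂X.μ

end Definitions

variable {X : Experiment n d K Z Ω} {L ρ σG σH G : ℝ}

/-- The averages of the local models form one sequence through all rounds: the last average of a
round is the next server model. This allows telescoping. -/
theorem virtual_H (r : ℕ) : X.virtual r X.H = X.glob (r + 1) := rfl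

namespace Valid

theorem virtual_zero (V : X.Valid L ρ σG σH G) (r : ℕ) : X.virtual r 0 = X.glob r :=
  funext fun _ => average_fin_const V.adm.n_pos _

theorem memLp_and_integral_sq_norm_direction_le (V : X.Valid L ρ σG σH G) (r : ℕ) (i : Fin n)
    (h : ℕ) (k k' : Fin K) :
    MemLp (fun ω => X.P.sampleDirection X.α i (X.loc r i h ω) (X.pers r i (h + 1) ω)
      (X.S (i, r, h, 1, k) ω) (X.S (i, r, h, 2, k') ω)) 2 X.μ ∧
    ∫ ω, ‖X.P.sampleDirection X.α i (X.loc r i h ω) (X.pers r i (h + 1) ω)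
      (X.S (i, r, h, 1, k) ω) (X.S (i, r, h, 2, k') ω)‖ ^ 2 ∂X.μ
        ≤ directionBound L σG σH G X.α := by
  have := V.prob
  have hl := (V.measurable_loc r i h).mono (X.hist_batch_le r h (Nat.zero_le 2)) le_rfl
  have hp := (V.measurable_pers_succ r i h).mono (X.hist_batch_le r h one_le_two) le_rfl
  have hz := X.measurable_sample i r h 1 k (b' := 2) (by simp)
  exact V.adm.memLp_and_integral_sq_norm_sampleDirection_le i
    ((V.measurable_loc r i h).mono (V.hist_le _ _ _) le_rfl)
    ((V.measurable_pers_succ r i h).mono (V.hist_le _ _ _) le_rfl) (V.meas_S _)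
    (V.run.law (i, r, h, 1, k)) (V.run.law (i, r, h, 2, k'))
    (V.indepFun_sample i r h 1 k (b' := 0) (by simp) (V.measurable_loc r i h))
    (V.indepFun_sample i r h 2 k' (b' := 2) (by simp) ((hl.prodMk hp).prodMk hz))

theorem memLp_step (V : X.Valid L ρ σG σH G) (r : ℕ) (i : Fin n) (h : ℕ) :
    MemLp (X.step r i h) 2 X.μ :=
  memLp_average fun k => memLp_average fun k' =>
    (V.memLp_and_integral_sq_norm_direction_le r i h k k').1

theorem integral_sq_norm_step_le (V : X.Valid L ρ σG σH G) (r : ℕ) (i : Fin n) (h : ℕ) :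
    ∫ ω, ‖X.step r i h ω‖ ^ 2 ∂X.μ ≤ directionBound L σG σH G X.α :=
  integral_sq_norm_average_le_of_le V.K_pos
    (fun k => memLp_average fun k' => (V.memLp_and_integral_sq_norm_direction_le r i h k k').1)
    fun k => integral_sq_norm_average_le_of_le V.K_pos
      (fun k' => (V.memLp_and_integral_sq_norm_direction_le r i h k k').1)
      fun k' => (V.memLp_and_integral_sq_norm_direction_le r i h k k').2

/-- The stochastic directions are conditionally unbiased. -/
theorem integral_inner_step (V : X.Valid L ρ σG σH G) (r : ℕ) (i : Fin n) (h : ℕ)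
    {y : Ω → Model d} (hy : Measurable[X.hist r h 1] y) {b : ℝ} (hb : ∀ ω, ‖y ω‖ ≤ b) :
    ∫ ω, ⟪y ω, X.step r i h ω⟫ ∂X.μ
      = ∫ ω, ⟪y ω, X.P.metaGrad X.α i (X.loc r i h ω) (X.pers r i (h + 1) ω)⟫ ∂X.μ := by
  have := V.prob
  have hym : Measurable y := hy.mono (V.hist_le _ _ _) le_rfl
  have hyL2 : MemLp y 2 X.μ :=
    MemLp.of_bound hym.aestronglyMeasurable b (Filter.Eventually.of_forall hb)
  have hl := (V.measurable_loc r i h).mono (X.hist_batch_le r h (Nat.zero_le 1)) le_rfl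
  have hp := V.measurable_pers_succ r i h
  -- Both models and `y` belong to stage `1`, hence are independent of a sample of batch `1`.
  -- Together with that sample they belong to stage `2`, hence are independent of a sample of batch
  -- `2`. All pairs have the same mean, so the double average collapses.
  have key : ∀ k k' : Fin K, ∫ ω, ⟪y ω, X.P.sampleDirection X.α i (X.loc r i h ω)
      (X.pers r i (h + 1) ω) (X.S (i, r, h, 1, k) ω) (X.S (i, r, h, 2, k') ω)⟫ ∂X.μ
      = ∫ ω, ⟪y ω, X.P.metaGrad X.α i (X.loc r i h ω) (X.pers r i (h + 1) ω)⟫ ∂X.μ := by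
    intro k k'
    have h12 := X.hist_batch_le r h one_le_two
    have hz := X.measurable_sample i r h 1 k (b' := 2) (by simp)
    exact V.adm.integral_inner_sampleDirection i hym hb (hl.mono (V.hist_le _ _ _) le_rfl)
      (hp.mono (V.hist_le _ _ _) le_rfl) (V.meas_S _)
      (V.run.law (i, r, h, 1, k)) (V.run.law (i, r, h, 2, k'))
      (V.indepFun_sample i r h 1 k (b' := 1) (by simp) (hy.prodMk (hl.prodMk hp)))
      (V.indepFun_sample i r h 2 k' (b' := 2) (by simp) ((hy.mono h12 le_rfl).prodMk
        (((hl.mono h12 le_rfl).prodMk (hp.mono h12 le_rfl)).prodMk hz)))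
  have hi : ∀ k k' : Fin K, Integrable (fun ω => ⟪y ω, X.P.sampleDirection X.α i (X.loc r i h ω)
      (X.pers r i (h + 1) ω) (X.S (i, r, h, 1, k) ω) (X.S (i, r, h, 2, k') ω)⟫) X.μ :=
    fun k k' => integrable_inner_of_memLp_two hyL2
      (V.memLp_and_integral_sq_norm_direction_le r i h k k').1
  have e : ∀ ω, ⟪y ω, X.step r i h ω⟫ = (K : ℝ)⁻¹ * ∑ k, (K : ℝ)⁻¹ * ∑ k',
      ⟪y ω, X.P.sampleDirection X.α i (X.loc r i h ω)
        (X.pers r i (h + 1) ω) (X.S (i, r, h, 1, k) ω) (X.S (i, r, h, 2, k') ω)⟫ := by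
    intro ω
    simp only [step, inner_smul_right, inner_sum]
  simp_rw [e]
  rw [integral_const_mul, integral_finsetSum _ fun k _ =>
    (integrable_finsetSum _ fun k' _ => hi k k').const_mul _]
  simp_rw [integral_const_mul]
  rw [Finset.sum_congr rfl fun k _ => by
    rw [integral_finsetSum _ fun k' _ => hi k k', Finset.sum_congr rfl fun k' _ => key k k']]
  have h1 := average_fin_const V.K_pos
    (∫ ω, ⟪y ω, X.P.metaGrad X.α i (X.loc r i h ω) (X.pers r i (h + 1) ω)⟫ ∂X.μ)
  simp only [smul_eq_mul] at h1
  rw [h1, h1]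

theorem loc_sub_glob (V : X.Valid L ρ σG σH G) (r : ℕ) (i : Fin n) (h : ℕ) (ω : Ω) :
    X.loc r i h ω - X.glob r ω = -(X.η • ∑ m ∈ Finset.range h, X.step r i m ω) := by
  induction h with
  | zero => simp [X.loc_zero]
  | succ h ih =>
    rw [X.loc_succ V.K_pos, Finset.sum_range_succ, smul_add, neg_add, ← ih]
    abel

theorem memLp_loc_sub_glob (V : X.Valid L ρ σG σH G) (r : ℕ) (i : Fin n) (h : ℕ) :
    MemLp (fun ω => X.loc r i h ω - X.glob r ω) 2 X.μ := by
  simp_rw [V.loc_sub_glob]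
  exact ((memLp_finsetSum (Finset.range h) fun m _ => V.memLp_step r i m).const_smul X.η).neg

theorem memLp_glob (V : X.Valid L ρ σG σH G) (r : ℕ) : MemLp (X.glob r) 2 X.μ := by
  have := V.prob
  induction r with
  | zero => exact memLp_const X.w₁
  | succ r ih =>
    refine memLp_average fun i => ?_
    have h1 := (V.memLp_loc_sub_glob r i X.H).add ih
    exact h1.ae_eq (Filter.Eventually.of_forall fun _ => sub_add_cancel _ _)

theorem memLp_loc (V : X.Valid L ρ σG σH G) (r : ℕ) (i : Fin n) (h : ℕ) :
    MemLp (X.loc r i h) 2 X.μ :=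
  ((V.memLp_loc_sub_glob r i h).add (V.memLp_glob r)).ae_eq
    (Filter.Eventually.of_forall fun _ => sub_add_cancel _ _)

theorem memLp_virtual (V : X.Valid L ρ σG σH G) (r h : ℕ) : MemLp (X.virtual r h) 2 X.μ :=
  memLp_average fun i => V.memLp_loc r i h

theorem memLp_adapt (V : X.Valid L ρ σG σH G) (i : Fin n) {w : Ω → Model d}
    (hw : MemLp w 2 X.μ) : MemLp (fun ω => X.P.adapt X.α i (w ω)) 2 X.μ := by
  have := V.prob
  have h1 : MemLp (fun ω => X.P.riskGrad i (w ω)) 2 X.μ :=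
    MemLp.of_bound ((V.adm.continuous_riskGrad i).comp_aestronglyMeasurable hw.1) G
      (Filter.Eventually.of_forall fun _ => V.adm.bounded i _)
  exact hw.sub (h1.const_smul X.α)

theorem driftBound_nonneg : 0 ≤ X.driftBound L σG σH G :=
  mul_nonneg (sq_nonneg _) (directionBound_nonneg ..)

/-- Cauchy–Schwarz over the iterations of the round. The directions need not have mean zero, so the
bound is quadratic in `H`; this suffices since `Hη` will be of order `ε`. -/
theorem integral_sq_norm_loc_sub_glob_le (V : X.Valid L ρ σG σH G) (r : ℕ) (i : Fin n) {h : ℕ}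
    (hh : h ≤ X.H) :
    ∫ ω, ‖X.loc r i h ω - X.glob r ω‖ ^ 2 ∂X.μ ≤ X.driftBound L σG σH G := by
  have hi : ∀ m, Integrable (fun ω => ‖X.step r i m ω‖ ^ 2) X.μ := fun m =>
    integrable_sq_norm_of_memLp_two (V.memLp_step r i m)
  calc ∫ ω, ‖X.loc r i h ω - X.glob r ω‖ ^ 2 ∂X.μ
      ≤ ∫ ω, X.η ^ 2 * (h * ∑ m ∈ Finset.range h, ‖X.step r i m ω‖ ^ 2) ∂X.μ := by
        refine integral_mono (integrable_sq_norm_of_memLp_two (V.memLp_loc_sub_glob r i h))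
          (((integrable_finsetSum _ fun m _ => hi m).const_mul _).const_mul _) fun ω => ?_
        simp only
        rw [V.loc_sub_glob, norm_neg, norm_smul, mul_pow, Real.norm_eq_abs, sq_abs]
        gcongr
        calc ‖∑ m ∈ Finset.range h, X.step r i m ω‖ ^ 2
            ≤ (∑ m ∈ Finset.range h, ‖X.step r i m ω‖) ^ 2 := by
              gcongr; exact norm_sum_le _ _
          _ ≤ _ := by
              simpa using sq_sum_le_card_mul_sum_sq (s := Finset.range h)
                (f := fun m => ‖X.step r i m ω‖)
    _ = X.η ^ 2 * (h * ∑ m ∈ Finset.range h, ∫ ω, ‖X.step r i m ω‖ ^ 2 ∂X.μ) := by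
        rw [integral_const_mul, integral_const_mul, integral_finsetSum _ fun m _ => hi m]
    _ ≤ X.η ^ 2 * (h * ∑ _m ∈ Finset.range h, directionBound L σG σH G X.α) := by
        gcongr with m
        exact V.integral_sq_norm_step_le r i m
    _ = (h * X.η) ^ 2 * directionBound L σG σH G X.α := by simp; ring
    _ ≤ X.driftBound L σG σH G := by
        have := directionBound_nonneg L σG σH G X.α
        have := V.η_nonneg
        unfold driftBound
        gcongr

theorem virtual_sub_glob (V : X.Valid L ρ σG σH G) (r h : ℕ) (ω : Ω) :
    X.virtual r h ω - X.glob r ω = (n : ℝ)⁻¹ • ∑ i, (X.loc r i h ω - X.glob r ω) := by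
  rw [Finset.sum_sub_distrib, smul_sub, average_fin_const V.adm.n_pos, virtual]

theorem integral_sq_norm_virtual_sub_glob_le (V : X.Valid L ρ σG σH G) (r : ℕ) {h : ℕ}
    (hh : h ≤ X.H) :
    ∫ ω, ‖X.virtual r h ω - X.glob r ω‖ ^ 2 ∂X.μ ≤ X.driftBound L σG σH G := by
  simp_rw [V.virtual_sub_glob]
  exact integral_sq_norm_average_le_of_le V.adm.n_pos (fun i => V.memLp_loc_sub_glob r i h)
    fun i => V.integral_sq_norm_loc_sub_glob_le r i hh

theorem integral_sq_norm_virtual_sub_loc_le (V : X.Valid L ρ σG σH G) (r : ℕ) (i : Fin n) {h : ℕ}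
    (hh : h ≤ X.H) :
    ∫ ω, ‖X.virtual r h ω - X.loc r i h ω‖ ^ 2 ∂X.μ ≤ 4 * X.driftBound L σG σH G := by
  have h1 := integrable_sq_norm_of_memLp_two ((V.memLp_virtual r h).sub (V.memLp_glob r))
  have h2 := integrable_sq_norm_of_memLp_two (V.memLp_loc_sub_glob r i h)
  have b1 := V.integral_sq_norm_virtual_sub_glob_le r hh
  have b2 := V.integral_sq_norm_loc_sub_glob_le r i hh
  calc ∫ ω, ‖X.virtual r h ω - X.loc r i h ω‖ ^ 2 ∂X.μ
      ≤ ∫ ω, (2 * ‖X.virtual r h ω - X.glob r ω‖ ^ 2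
          + 2 * ‖X.loc r i h ω - X.glob r ω‖ ^ 2) ∂X.μ := by
        refine integral_mono (integrable_sq_norm_of_memLp_two
          ((V.memLp_virtual r h).sub (V.memLp_loc r i h)))
          ((h1.const_mul 2).add (h2.const_mul 2)) fun ω => ?_
        have := sq_norm_sub_le_two_mul (X.virtual r h ω - X.glob r ω) (X.loc r i h ω - X.glob r ω)
        rwa [sub_sub_sub_cancel_right] at this
    _ = 2 * ∫ ω, ‖X.virtual r h ω - X.glob r ω‖ ^ 2 ∂X.μ
          + 2 * ∫ ω, ‖X.loc r i h ω - X.glob r ω‖ ^ 2 ∂X.μ := by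
        rw [← integral_const_mul, ← integral_const_mul]
        exact integral_add (h1.const_mul 2) (h2.const_mul 2)
    _ ≤ _ := by linarith

end Valid

end Experiment

/-! ### Recursion of the lag of the personalized models. -/

/-- Young's inequality with weight `b`. -/
theorem sq_norm_sub_le_young {E : Type*} [SeminormedAddCommGroup E] (x y : E) {b : ℝ}
    (hb : 0 < b) : ‖x - y‖ ^ 2 ≤ (1 + b) * ‖x‖ ^ 2 + (1 + b⁻¹) * ‖y‖ ^ 2 := by
  have h := norm_sub_le x y
  have h0 := norm_nonneg (x - y)
  have h1 : 2 * (‖x‖ * ‖y‖) ≤ b * ‖x‖ ^ 2 + b⁻¹ * ‖y‖ ^ 2 := by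
    have h2 : 0 ≤ b⁻¹ * (b * ‖x‖ - ‖y‖) ^ 2 := by positivity
    have h3 : b⁻¹ * (b * ‖x‖ - ‖y‖) ^ 2
        = b * ‖x‖ ^ 2 + b⁻¹ * ‖y‖ ^ 2 - 2 * (‖x‖ * ‖y‖) := by
      field_simp; ring
    linarith
  nlinarith

theorem integral_le_of_le_add {Ω : Type*} [MeasurableSpace Ω] {μ : Measure Ω} {f g k : Ω → ℝ}
    (hf : Integrable f μ) (hg : Integrable g μ) (hk : Integrable k μ) (a b : ℝ)
    (h : ∀ ω, f ω ≤ a * g ω + b * k ω) : ∫ ω, f ω ∂μ ≤ a * ∫ ω, g ω ∂μ + b * ∫ ω, k ω ∂μ := by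
  rw [← integral_const_mul, ← integral_const_mul,
    ← integral_add (hg.const_mul _) (hk.const_mul _)]
  exact integral_mono hf ((hg.const_mul _).add (hk.const_mul _)) h

theorem integral_le_of_le_add_add {Ω : Type*} [MeasurableSpace Ω] {μ : Measure Ω}
    {f g k l : Ω → ℝ} (hf : Integrable f μ) (hg : Integrable g μ) (hk : Integrable k μ)
    (hl : Integrable l μ) (a b c : ℝ) (h : ∀ ω, f ω ≤ a * g ω + b * k ω + c * l ω) :
    ∫ ω, f ω ∂μ ≤ a * ∫ ω, g ω ∂μ + b * ∫ ω, k ω ∂μ + c * ∫ ω, l ω ∂μ := by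
  have h1 := integral_le_of_le_add hf ((hg.const_mul a).add (hk.const_mul b)) hl 1 c
    (fun ω => by simpa using h ω)
  have h2 : ∫ ω, ((fun ω => a * g ω) + fun ω => b * k ω) ω ∂μ
      = a * ∫ ω, g ω ∂μ + b * ∫ ω, k ω ∂μ := by
    rw [← integral_const_mul, ← integral_const_mul]
    exact integral_add (hg.const_mul _) (hk.const_mul _)
  rw [h2, one_mul] at h1
  exact h1

theorem Tasks.Admissible.aestronglyMeasurable_metaGrad {n d : ℕ} {Z : Type*} [MeasurableSpace Z]
    {P : Tasks n d Z} {L ρ σG σH G α : ℝ} (h : P.Admissible L ρ σG σH G α) {Ω : Type*}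
    [MeasurableSpace Ω] {μ : Measure Ω} (i : Fin n) {w u : Ω → Model d}
    (hw : AEStronglyMeasurable w μ) (hu : AEStronglyMeasurable u μ) :
    AEStronglyMeasurable (fun ω => P.metaGrad α i (w ω) (u ω)) μ :=
  Continuous.comp_aestronglyMeasurable₂ (g := P.metaGrad α i) (h.continuous_metaGrad i) hw hu

namespace Experiment

variable {n d K : ℕ} {Z Ω : Type*} [MeasurableSpace Z] [MeasurableSpace Ω]

/-- The error of the mini-batch gradient used in the update of the personalized model. -/
noncomputable def gradNoise (X : Experiment n d K Z Ω) (r : ℕ) (i : Fin n) (h : ℕ) (ω : Ω) :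
    Model d :=
  (K : ℝ)⁻¹ • ∑ k, (X.P.sampleGrad i (X.loc r i h ω) (X.S (i, r, h, 0, k) ω)
    - X.P.riskGrad i (X.loc r i h ω))

variable {X : Experiment n d K Z Ω} {L ρ σG σH G : ℝ}

namespace Valid

/-- The moving average aims at the adaptation of the same local model from which the old lag is
measured, so the old lag shrinks exactly by `1 - β` and only noise is added. -/
theorem freshLag_eq (V : X.Valid L ρ σG σH G) (r : ℕ) (i : Fin n) (h : ℕ) (ω : Ω) :
    X.freshLag r i h ω
      = (1 - X.β) • X.lag r i h ω - (X.β * X.α) • X.gradNoise r i h ω := by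
  have h1 : X.P.batchGrad i (fun k => X.S (i, r, h, 0, k) ω) (X.loc r i h ω)
      = X.gradNoise r i h ω + X.P.riskGrad i (X.loc r i h ω) := by
    rw [gradNoise, Finset.sum_sub_distrib, smul_sub, average_fin_const V.K_pos, Tasks.batchGrad]
    abel
  rw [freshLag, X.pers_succ, h1, lag, Tasks.adapt]
  module

theorem memLp_and_integral_sq_norm_sampleNoise_le (V : X.Valid L ρ σG σH G) (r : ℕ) (i : Fin n)
    (h : ℕ) (k : Fin K) :
    MemLp (fun ω => X.P.sampleGrad i (X.loc r i h ω) (X.S (i, r, h, 0, k) ω)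
      - X.P.riskGrad i (X.loc r i h ω)) 2 X.μ ∧
    ∫ ω, ‖X.P.sampleGrad i (X.loc r i h ω) (X.S (i, r, h, 0, k) ω)
      - X.P.riskGrad i (X.loc r i h ω)‖ ^ 2 ∂X.μ ≤ σG ^ 2 := by
  have := V.prob
  exact V.adm.memLp_and_integral_sq_norm_sampleGrad_sub_le i
    ((V.measurable_loc r i h).mono (V.hist_le _ _ _) le_rfl) (V.run.law (i, r, h, 0, k))
    (V.indepFun_sample i r h 0 k (b' := 0) (by simp) (V.measurable_loc r i h))

theorem memLp_gradNoise (V : X.Valid L ρ σG σH G) (r : ℕ) (i : Fin n) (h : ℕ) :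
    MemLp (X.gradNoise r i h) 2 X.μ :=
  memLp_average fun k => (V.memLp_and_integral_sq_norm_sampleNoise_le r i h k).1

theorem integral_sq_norm_gradNoise_le (V : X.Valid L ρ σG σH G) (r : ℕ) (i : Fin n) (h : ℕ) :
    ∫ ω, ‖X.gradNoise r i h ω‖ ^ 2 ∂X.μ ≤ σG ^ 2 :=
  integral_sq_norm_average_le_of_le V.K_pos
    (fun k => (V.memLp_and_integral_sq_norm_sampleNoise_le r i h k).1)
    fun k => (V.memLp_and_integral_sq_norm_sampleNoise_le r i h k).2

theorem memLp_pers_zero_of (V : X.Valid L ρ σG σH G) {r : ℕ} {i : Fin n}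
    (h0 : MemLp (X.pers r i 0) 2 X.μ) (h : ℕ) : MemLp (X.pers r i h) 2 X.μ := by
  induction h with
  | zero => exact h0
  | succ h ih =>
    have ha := V.memLp_adapt i (V.memLp_loc r i h)
    have hl : MemLp (X.lag r i h) 2 X.μ := ih.sub ha
    have hf : MemLp (X.freshLag r i h) 2 X.μ :=
      ((hl.const_smul (1 - X.β)).sub ((V.memLp_gradNoise r i h).const_smul (X.β * X.α))).ae_eq
        (Filter.Eventually.of_forall fun ω => (V.freshLag_eq r i h ω).symm)
    exact (hf.add ha).ae_eq (Filter.Eventually.of_forall fun ω => sub_add_cancel _ _)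

theorem memLp_pers (V : X.Valid L ρ σG σH G) (r : ℕ) (i : Fin n) (h : ℕ) :
    MemLp (X.pers r i h) 2 X.μ := by
  induction r generalizing h with
  | zero => exact V.memLp_pers_zero_of (r := 0) (i := i) (V.run.memLp_init i) h
  | succ r ih => exact V.memLp_pers_zero_of (r := r + 1) (i := i) (ih X.H) h

theorem memLp_lag (V : X.Valid L ρ σG σH G) (r : ℕ) (i : Fin n) (h : ℕ) :
    MemLp (X.lag r i h) 2 X.μ :=
  (V.memLp_pers r i h).sub (V.memLp_adapt i (V.memLp_loc r i h))

theorem memLp_freshLag (V : X.Valid L ρ σG σH G) (r : ℕ) (i : Fin n) (h : ℕ) :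
    MemLp (X.freshLag r i h) 2 X.μ :=
  (V.memLp_pers r i (h + 1)).sub (V.memLp_adapt i (V.memLp_loc r i h))

theorem measurable_lag (V : X.Valid L ρ σG σH G) (r : ℕ) (i : Fin n) (h : ℕ) :
    Measurable[X.hist r h 0] (X.lag r i h) :=
  (V.measurable_pers r i h).sub
    ((V.adm.continuous_adapt i).measurable.comp (V.measurable_loc r i h))

theorem integral_inner_lag_gradNoise (V : X.Valid L ρ σG σH G) (r : ℕ) (i : Fin n) (h : ℕ) :
    ∫ ω, ⟪X.lag r i h ω, X.gradNoise r i h ω⟫ ∂X.μ = 0 := by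
  have := V.prob
  have hl := V.measurable_lag r i h
  have hw := V.measurable_loc r i h
  have key : ∀ k : Fin K, ∫ ω, ⟪X.lag r i h ω,
      X.P.sampleGrad i (X.loc r i h ω) (X.S (i, r, h, 0, k) ω)
        - X.P.riskGrad i (X.loc r i h ω)⟫ ∂X.μ = 0 := fun k =>
    V.adm.integral_inner_sampleGrad_sub i (hl.mono (V.hist_le _ _ _) le_rfl) (V.memLp_lag r i h)
      (hw.mono (V.hist_le _ _ _) le_rfl) (V.run.law (i, r, h, 0, k))
      (V.indepFun_sample i r h 0 k (b' := 0) (by simp) (hl.prodMk hw))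
  simp only [gradNoise, inner_smul_right, inner_sum]
  rw [integral_const_mul, integral_finsetSum _ fun k _ => integrable_inner_of_memLp_two
    (V.memLp_lag r i h) (V.memLp_and_integral_sq_norm_sampleNoise_le r i h k).1]
  simp [key]

/-- Expanding the square leaves no cross term, since batch `0` is fresh. The full factor `(1 - β)²`
survives, which leaves room for the loss from the motion of the local model. -/
theorem integral_sq_norm_freshLag_le (V : X.Valid L ρ σG σH G) (r : ℕ) (i : Fin n) (h : ℕ) :
    ∫ ω, ‖X.freshLag r i h ω‖ ^ 2 ∂X.μ
      ≤ (1 - X.β) ^ 2 * ∫ ω, ‖X.lag r i h ω‖ ^ 2 ∂X.μ + X.β ^ 2 * (X.α * σG) ^ 2 := by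
  have i1 := integrable_sq_norm_of_memLp_two (V.memLp_lag r i h)
  have i2 := integrable_sq_norm_of_memLp_two (V.memLp_gradNoise r i h)
  have i3 := integrable_inner_of_memLp_two (V.memLp_lag r i h) (V.memLp_gradNoise r i h)
  have h0 := integral_le_of_le_add_add (integrable_sq_norm_of_memLp_two (V.memLp_freshLag r i h))
    i1 i3 i2 ((1 - X.β) ^ 2) (-(2 * (1 - X.β) * (X.β * X.α))) ((X.β * X.α) ^ 2) fun ω => by
      rw [V.freshLag_eq, norm_sub_sq_real, norm_smul, norm_smul, inner_smul_left, inner_smul_right,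
        mul_pow, mul_pow, Real.norm_eq_abs, Real.norm_eq_abs, sq_abs, sq_abs]
      simp only [conj_trivial]
      exact le_of_eq (by ring)
  rw [V.integral_inner_lag_gradNoise] at h0
  have h1 := V.integral_sq_norm_gradNoise_le r i h
  have h2 : (X.β * X.α) ^ 2 * ∫ ω, ‖X.gradNoise r i h ω‖ ^ 2 ∂X.μ
      ≤ (X.β * X.α) ^ 2 * σG ^ 2 := by gcongr
  nlinarith

theorem lagBound_nonneg (V : X.Valid L ρ σG σH G) : 0 ≤ X.lagBound L σG σH G := by
  have := directionBound_nonneg L σG σH G X.α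
  have := V.β_pos
  unfold lagBound; positivity

/-- The recursion of the mean squared lag over one local iteration. -/
theorem integral_sq_norm_lag_succ_le (V : X.Valid L ρ σG σH G) (r : ℕ) (i : Fin n) (h : ℕ) :
    ∫ ω, ‖X.lag r i (h + 1) ω‖ ^ 2 ∂X.μ
      ≤ (1 - X.β) * ∫ ω, ‖X.lag r i h ω‖ ^ 2 ∂X.μ + X.β * X.lagBound L σG σH G := by
  have i1 := integrable_sq_norm_of_memLp_two (V.memLp_freshLag r i h)
  have i2 := integrable_sq_norm_of_memLp_two (V.memLp_step r i h)
  have hβ := V.β_pos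
  have hβ1 := V.β_le
  set l := adaptLip L X.α with hl
  set M := directionBound L σG σH G X.α with hM
  have hlp : 1 ≤ l := V.adm.adaptLip_pos
  have hM0 : 0 ≤ M := directionBound_nonneg L σG σH G X.α
  have hinv : 1 ≤ X.β⁻¹ := (one_le_inv₀ hβ).2 hβ1
  -- Young's inequality with weight `β`: the loss `1 + β` is compensated by `(1 - β)²`, and the
  -- weight `1 + β⁻¹` on the squared step of order `η²` produces the term `η²/β²` of `lagBound`
  -- after division by `β`.
  have hpt : ∀ ω, ‖X.lag r i (h + 1) ω‖ ^ 2 ≤ (1 + X.β) * ‖X.freshLag r i h ω‖ ^ 2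
      + (1 + X.β⁻¹) * (l * X.η) ^ 2 * ‖X.step r i h ω‖ ^ 2 := by
    intro ω
    have e : X.lag r i (h + 1) ω = X.freshLag r i h ω
        - (X.P.adapt X.α i (X.loc r i (h + 1) ω) - X.P.adapt X.α i (X.loc r i h ω)) := by
      simp only [lag, freshLag]; abel
    have h1 : ‖X.P.adapt X.α i (X.loc r i (h + 1) ω) - X.P.adapt X.α i (X.loc r i h ω)‖
        ≤ l * X.η * ‖X.step r i h ω‖ := by
      refine (V.adm.norm_adapt_sub_le i _ _).trans ?_
      rw [X.loc_succ V.K_pos, sub_sub_cancel_left, norm_neg, norm_smul,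
        Real.norm_of_nonneg V.η_nonneg, mul_assoc]
    rw [e]
    refine (sq_norm_sub_le_young _ _ hβ).trans ?_
    rw [mul_assoc (1 + X.β⁻¹), ← mul_pow]
    gcongr
  have h1 : ∫ ω, ‖X.lag r i (h + 1) ω‖ ^ 2 ∂X.μ
      ≤ (1 + X.β) * ∫ ω, ‖X.freshLag r i h ω‖ ^ 2 ∂X.μ
        + (1 + X.β⁻¹) * (l * X.η) ^ 2 * ∫ ω, ‖X.step r i h ω‖ ^ 2 ∂X.μ := by
    exact integral_le_of_le_add (integrable_sq_norm_of_memLp_two (V.memLp_lag r i (h + 1)))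
      i1 i2 _ _ hpt
  have h2 := V.integral_sq_norm_freshLag_le r i h
  have h3 := V.integral_sq_norm_step_le r i h
  set a := ∫ ω, ‖X.lag r i h ω‖ ^ 2 ∂X.μ
  have ha : 0 ≤ a := integral_nonneg fun _ => by positivity
  calc _ ≤ (1 + X.β) * ((1 - X.β) ^ 2 * a + X.β ^ 2 * (X.α * σG) ^ 2)
        + (2 * X.β⁻¹) * (l * X.η) ^ 2 * M := by
        refine h1.trans ?_
        have hc : 1 + X.β⁻¹ ≤ 2 * X.β⁻¹ := by linarith
        gcongr
    _ ≤ ((1 - X.β) * a + 2 * (X.β ^ 2 * (X.α * σG) ^ 2)) + (2 * X.β⁻¹) * (l * X.η) ^ 2 * M := by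
        have c1 : (1 + X.β) * (1 - X.β) ^ 2 ≤ 1 - X.β := by nlinarith [sq_nonneg X.β]
        have c2 := mul_le_mul_of_nonneg_right c1 ha
        have c3 : (1 + X.β) * (X.β ^ 2 * (X.α * σG) ^ 2) ≤ 2 * (X.β ^ 2 * (X.α * σG) ^ 2) := by
          gcongr; linarith
        nlinarith
    _ = _ := by
        unfold lagBound
        rw [← hl, ← hM]
        field_simp
        ring

/-- `lagBound` is the fixed point of the one-step recursion, so it bounds the accumulated errors for
every `h`. -/
theorem integral_sq_norm_lag_le (V : X.Valid L ρ σG σH G) (r : ℕ) (i : Fin n) (h : ℕ) :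
    ∫ ω, ‖X.lag r i h ω‖ ^ 2 ∂X.μ
      ≤ (1 - X.β) ^ h * ∫ ω, ‖X.lag r i 0 ω‖ ^ 2 ∂X.μ + X.lagBound L σG σH G := by
  have hB := V.lagBound_nonneg
  induction h with
  | zero => simpa using hB
  | succ h ih =>
    refine (V.integral_sq_norm_lag_succ_le r i h).trans ?_
    have hβ1 := sub_nonneg.2 V.β_le
    have := mul_le_mul_of_nonneg_left ih hβ1
    rw [pow_succ]
    nlinarith

/-- A bound uniform in `h`, so that the lag at the start of a round controls the whole round. The
second `lagBound` absorbs the noise of the last update. -/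
theorem integral_sq_norm_freshLag_le_add (V : X.Valid L ρ σG σH G) (r : ℕ) (i : Fin n) (h : ℕ) :
    ∫ ω, ‖X.freshLag r i h ω‖ ^ 2 ∂X.μ
      ≤ ∫ ω, ‖X.lag r i 0 ω‖ ^ 2 ∂X.μ + 2 * X.lagBound L σG σH G := by
  have h1 := V.integral_sq_norm_freshLag_le r i h
  have h2 := V.integral_sq_norm_lag_le r i h
  have hβ := V.β_pos
  have hβ1 := V.β_le
  have ha : ∀ h, 0 ≤ ∫ ω, ‖X.lag r i h ω‖ ^ 2 ∂X.μ := fun h =>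
    integral_nonneg fun _ => by positivity
  have c1 : (1 - X.β) ^ 2 * ∫ ω, ‖X.lag r i h ω‖ ^ 2 ∂X.μ ≤ ∫ ω, ‖X.lag r i h ω‖ ^ 2 ∂X.μ :=
    mul_le_of_le_one_left (ha h) (pow_le_one₀ (by linarith) (by linarith))
  have c2 : (1 - X.β) ^ h * ∫ ω, ‖X.lag r i 0 ω‖ ^ 2 ∂X.μ ≤ ∫ ω, ‖X.lag r i 0 ω‖ ^ 2 ∂X.μ :=
    mul_le_of_le_one_left (ha 0) (pow_le_one₀ (by linarith) (by linarith))
  have c3 : X.β ^ 2 * (X.α * σG) ^ 2 ≤ X.lagBound L σG σH G := by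
    have h3 : X.β ^ 2 ≤ 2 * X.β := by nlinarith
    have h4 : X.β ^ 2 * (X.α * σG) ^ 2 ≤ 2 * X.β * (X.α * σG) ^ 2 := by gcongr
    have h5 : 0 ≤ 2 * adaptLip L X.α ^ 2 * directionBound L σG σH G X.α * (X.η ^ 2 / X.β ^ 2) := by
      have := directionBound_nonneg L σG σH G X.α
      positivity
    unfold lagBound; linarith
  linarith

/-- The recursion of the mean squared lag over one round. -/
theorem integral_sq_norm_lag_round_le (V : X.Valid L ρ σG σH G)
    (hH : (1 - X.β) ^ X.H ≤ 1 / 4) (r : ℕ) (i : Fin n) :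
    ∫ ω, ‖X.lag (r + 1) i 0 ω‖ ^ 2 ∂X.μ ≤ 1 / 2 * ∫ ω, ‖X.lag r i 0 ω‖ ^ 2 ∂X.μ
      + (2 * X.lagBound L σG σH G + 8 * adaptLip L X.α ^ 2 * X.driftBound L σG σH G) := by
  have i1 := integrable_sq_norm_of_memLp_two (V.memLp_lag r i X.H)
  have i2 := integrable_sq_norm_of_memLp_two ((V.memLp_virtual r X.H).sub (V.memLp_loc r i X.H))
  have hpt : ∀ ω, ‖X.lag (r + 1) i 0 ω‖ ^ 2 ≤ 2 * ‖X.lag r i X.H ω‖ ^ 2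
      + 2 * adaptLip L X.α ^ 2 * ‖X.virtual r X.H ω - X.loc r i X.H ω‖ ^ 2 := by
    intro ω
    -- At the end of a round `u` is kept while the local model jumps to the average. Squaring costs
    -- a factor `2`, which turns the contraction `1/4` into `1/2` and the bound `4 * driftBound`
    -- into the constant `8`.
    have e : X.lag (r + 1) i 0 ω = X.lag r i X.H ω
        - (X.P.adapt X.α i (X.virtual r X.H ω) - X.P.adapt X.α i (X.loc r i X.H ω)) := by
      simp only [lag, X.pers_succ_zero, X.loc_zero, virtual_H]; abel
    rw [e]
    refine (sq_norm_sub_le_two_mul _ _).trans ?_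
    rw [mul_assoc 2 (adaptLip L X.α ^ 2), ← mul_pow]
    gcongr
    exact V.adm.norm_adapt_sub_le i _ _
  have h1 : ∫ ω, ‖X.lag (r + 1) i 0 ω‖ ^ 2 ∂X.μ ≤ 2 * ∫ ω, ‖X.lag r i X.H ω‖ ^ 2 ∂X.μ
      + 2 * adaptLip L X.α ^ 2 * ∫ ω, ‖X.virtual r X.H ω - X.loc r i X.H ω‖ ^ 2 ∂X.μ := by
    exact integral_le_of_le_add (integrable_sq_norm_of_memLp_two (V.memLp_lag (r + 1) i 0))
      i1 i2 _ _ hpt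
  have h2 := V.integral_sq_norm_lag_le r i X.H
  have h3 := mul_le_mul_of_nonneg_left (V.integral_sq_norm_virtual_sub_loc_le r i le_rfl)
    (by positivity : 0 ≤ 2 * adaptLip L X.α ^ 2)
  have h4 : (1 - X.β) ^ X.H * ∫ ω, ‖X.lag r i 0 ω‖ ^ 2 ∂X.μ
      ≤ 1 / 4 * ∫ ω, ‖X.lag r i 0 ω‖ ^ 2 ∂X.μ :=
    mul_le_mul_of_nonneg_right hH (integral_nonneg fun _ => by positivity)
  linarith

theorem meanLag_succ_le (V : X.Valid L ρ σG σH G) (hH : (1 - X.β) ^ X.H ≤ 1 / 4) (r : ℕ) :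
    X.meanLag (r + 1) ≤ 1 / 2 * X.meanLag r
      + (2 * X.lagBound L σG σH G + 8 * adaptLip L X.α ^ 2 * X.driftBound L σG σH G) := by
  have h1 : X.meanLag (r + 1) ≤ (n : ℝ)⁻¹ * ∑ i, (1 / 2 * ∫ ω, ‖X.lag r i 0 ω‖ ^ 2 ∂X.μ
      + (2 * X.lagBound L σG σH G + 8 * adaptLip L X.α ^ 2 * X.driftBound L σG σH G)) := by
    unfold meanLag
    gcongr with i
    exact V.integral_sq_norm_lag_round_le hH r i
  refine h1.trans_eq ?_
  have h2 := average_fin_const V.adm.n_pos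
    (2 * X.lagBound L σG σH G + 8 * adaptLip L X.α ^ 2 * X.driftBound L σG σH G)
  rw [smul_eq_mul] at h2
  rw [Finset.sum_add_distrib, mul_add, h2, ← Finset.mul_sum, meanLag]
  ring

theorem meanLag_nonneg (r : ℕ) : 0 ≤ X.meanLag r :=
  mul_nonneg (by positivity) (Finset.sum_nonneg fun _ _ => integral_nonneg fun _ => by positivity)

theorem sum_meanLag_le (V : X.Valid L ρ σG σH G) (hH : (1 - X.β) ^ X.H ≤ 1 / 4) (R : ℕ) :
    ∑ r ∈ Finset.range R, X.meanLag r ≤ 2 * X.meanLag 0 + R * (2 *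
      (2 * X.lagBound L σG σH G + 8 * adaptLip L X.α ^ 2 * X.driftBound L σG σH G)) := by
  -- The term `2 * meanLag R` is a potential: halving the lag frees exactly the summand of the next
  -- round.
  have key : ∑ r ∈ Finset.range R, X.meanLag r + 2 * X.meanLag R ≤ 2 * X.meanLag 0 + R * (2 *
      (2 * X.lagBound L σG σH G + 8 * adaptLip L X.α ^ 2 * X.driftBound L σG σH G)) := by
    induction R with
    | zero => simp
    | succ R ih =>
      rw [Finset.sum_range_succ]
      push_cast
      have := V.meanLag_succ_le hH R
      linarith
  have := meanLag_nonneg (X := X) R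
  linarith

/-! ### Descent of the meta-objective -/

theorem memLp_metaGrad (V : X.Valid L ρ σG σH G) (r : ℕ) (i : Fin n) (h : ℕ) :
    MemLp (fun ω => X.P.metaGrad X.α i (X.loc r i h ω) (X.pers r i (h + 1) ω)) 2 X.μ := by
  have := V.prob
  exact MemLp.of_bound (V.adm.aestronglyMeasurable_metaGrad i (V.memLp_loc r i h).1
    (V.memLp_pers r i (h + 1)).1) (adaptLip L X.α * G)
    (Filter.Eventually.of_forall fun _ => V.adm.norm_metaGrad_le i _ _)

theorem memLp_gradient (V : X.Valid L ρ σG σH G) {w : Ω → Model d}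
    (hw : AEStronglyMeasurable w X.μ) :
    MemLp (fun ω => gradient (X.P.metaObjective X.α) (w ω)) 2 X.μ := by
  have := V.prob
  exact MemLp.of_bound (V.adm.continuous_gradient_metaObjective.comp_aestronglyMeasurable hw)
    (adaptLip L X.α * G) (Filter.Eventually.of_forall fun _ => V.adm.norm_gradient_metaObjective_le _)

theorem integrable_metaObjective (V : X.Valid L ρ σG σH G) {w : Ω → Model d}
    (hw : MemLp w 2 X.μ) : Integrable (fun ω => X.P.metaObjective X.α (w ω)) X.μ := by
  have := V.prob
  have h1 : Integrable (fun ω => adaptLip L X.α * G * ‖w ω - X.w₁‖) X.μ :=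
    ((hw.sub (memLp_const X.w₁)).integrable one_le_two).norm.const_mul _
  have h2 : Integrable (fun ω => X.P.metaObjective X.α (w ω) - X.P.metaObjective X.α X.w₁) X.μ :=
    h1.mono' ((V.adm.continuous_metaObjective.comp_aestronglyMeasurable hw.1).sub
      aestronglyMeasurable_const) (Filter.Eventually.of_forall fun ω =>
        V.adm.abs_metaObjective_sub_le _ _)
  exact (h2.add (integrable_const (X.P.metaObjective X.α X.w₁))).congr
    (Filter.Eventually.of_forall fun ω => sub_add_cancel _ _)

theorem virtual_succ (V : X.Valid L ρ σG σH G) (r h : ℕ) (ω : Ω) :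
    X.virtual r (h + 1) ω = X.virtual r h ω - X.η • ((n : ℝ)⁻¹ • ∑ i, X.step r i h ω) := by
  simp only [virtual, X.loc_succ V.K_pos, Finset.sum_sub_distrib, smul_sub, ← Finset.smul_sum,
    smul_comm (n : ℝ)⁻¹ X.η]

/-- A history contains the earlier samples of all clients, as if they ran in lockstep, so the
average model belongs to it. Stage `1` is the stage required by `integral_inner_step`. -/
theorem measurable_gradient_virtual (V : X.Valid L ρ σG σH G) (r h : ℕ) :
    Measurable[X.hist r h 1] fun ω => gradient (X.P.metaObjective X.α) (X.virtual r h ω) := by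
  have h1 : Measurable[X.hist r h 1] (X.virtual r h) := measurable_average fun i =>
    (V.measurable_loc r i h).mono (X.hist_batch_le r h (Nat.zero_le 1)) le_rfl
  exact V.adm.continuous_gradient_metaObjective.measurable.comp h1

/-- The expected distance between the gradient at the average model and the mean direction. -/
theorem integral_sq_norm_gradient_sub_le (V : X.Valid L ρ σG σH G) (r : ℕ) {h : ℕ}
    (hh : h ≤ X.H) :
    ∫ ω, ‖gradient (X.P.metaObjective X.α) (X.virtual r h ω)
        - (n : ℝ)⁻¹ • ∑ i, X.P.metaGrad X.α i (X.loc r i h ω) (X.pers r i (h + 1) ω)‖ ^ 2 ∂X.μ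
      ≤ 8 * metaLip L ρ G X.α ^ 2 * X.driftBound L σG σH G
        + 2 * (adaptLip L X.α * L) ^ 2 * (X.meanLag r + 2 * X.lagBound L σG σH G) := by
  set f : Fin n → Ω → Model d := fun i ω =>
    X.P.metaGrad X.α i (X.virtual r h ω) (X.P.adapt X.α i (X.virtual r h ω))
      - X.P.metaGrad X.α i (X.loc r i h ω) (X.pers r i (h + 1) ω) with hf
  have := V.prob
  have hfL : ∀ i, MemLp (f i) 2 X.μ := by
    intro i
    have h1 : MemLp (fun ω => X.P.metaGrad X.α i (X.virtual r h ω)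
        (X.P.adapt X.α i (X.virtual r h ω))) 2 X.μ :=
      MemLp.of_bound (V.adm.aestronglyMeasurable_metaGrad i (V.memLp_virtual r h).1
        (V.memLp_adapt i (V.memLp_virtual r h)).1)
        (adaptLip L X.α * G) (Filter.Eventually.of_forall fun _ => V.adm.norm_metaGrad_le i _ _)
    exact h1.sub (V.memLp_metaGrad r i h)
  have hfb : ∀ i, ∫ ω, ‖f i ω‖ ^ 2 ∂X.μ ≤ 8 * metaLip L ρ G X.α ^ 2 * X.driftBound L σG σH G
      + 2 * (adaptLip L X.α * L) ^ 2 * (∫ ω, ‖X.lag r i 0 ω‖ ^ 2 ∂X.μ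
        + 2 * X.lagBound L σG σH G) := by
    intro i
    have i1 := integrable_sq_norm_of_memLp_two ((V.memLp_virtual r h).sub (V.memLp_loc r i h))
    have i2 := integrable_sq_norm_of_memLp_two (V.memLp_freshLag r i h)
    have hpt : ∀ ω, ‖f i ω‖ ^ 2 ≤ 2 * metaLip L ρ G X.α ^ 2
        * ‖X.virtual r h ω - X.loc r i h ω‖ ^ 2
        + 2 * (adaptLip L X.α * L) ^ 2 * ‖X.freshLag r i h ω‖ ^ 2 := by
      intro ω
      -- The intermediate point is the exact direction at the local model. The first difference is
      -- due to the drift, the second only to the lag.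
      have e : f i ω = (X.P.metaGrad X.α i (X.virtual r h ω) (X.P.adapt X.α i (X.virtual r h ω))
          - X.P.metaGrad X.α i (X.loc r i h ω) (X.P.adapt X.α i (X.loc r i h ω)))
          - (X.P.metaGrad X.α i (X.loc r i h ω) (X.pers r i (h + 1) ω)
            - X.P.metaGrad X.α i (X.loc r i h ω) (X.P.adapt X.α i (X.loc r i h ω))) := by
        simp only [hf]; abel
      have h2 := V.adm.norm_metaGrad_sub_le i (X.loc r i h ω) (X.pers r i (h + 1) ω)
        (X.loc r i h ω) (X.P.adapt X.α i (X.loc r i h ω))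
      rw [sub_self, norm_zero, mul_zero, zero_add] at h2
      rw [e]
      refine (sq_norm_sub_le_two_mul _ _).trans ?_
      rw [mul_assoc 2 (metaLip L ρ G X.α ^ 2), mul_assoc 2 ((adaptLip L X.α * L) ^ 2), ← mul_pow,
        ← mul_pow]
      gcongr
      · exact V.adm.norm_metaGrad_adapt_sub_le i _ _
      · exact h2
    have h1 : ∫ ω, ‖f i ω‖ ^ 2 ∂X.μ ≤ 2 * metaLip L ρ G X.α ^ 2
        * ∫ ω, ‖X.virtual r h ω - X.loc r i h ω‖ ^ 2 ∂X.μ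
        + 2 * (adaptLip L X.α * L) ^ 2 * ∫ ω, ‖X.freshLag r i h ω‖ ^ 2 ∂X.μ := by
      exact integral_le_of_le_add (integrable_sq_norm_of_memLp_two (hfL i)) i1 i2 _ _ hpt
    have h2 := mul_le_mul_of_nonneg_left (V.integral_sq_norm_virtual_sub_loc_le r i hh)
      (by positivity : 0 ≤ 2 * metaLip L ρ G X.α ^ 2)
    have h3 := mul_le_mul_of_nonneg_left (V.integral_sq_norm_freshLag_le_add r i h)
      (by positivity : 0 ≤ 2 * (adaptLip L X.α * L) ^ 2)
    linarith
  have e : ∀ ω, gradient (X.P.metaObjective X.α) (X.virtual r h ω)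
      - (n : ℝ)⁻¹ • ∑ i, X.P.metaGrad X.α i (X.loc r i h ω) (X.pers r i (h + 1) ω)
      = (n : ℝ)⁻¹ • ∑ i, f i ω := by
    intro ω
    rw [V.adm.regular.gradient_metaObjective, ← smul_sub, ← Finset.sum_sub_distrib]
  simp_rw [e]
  refine (integral_sq_norm_average_le V.adm.n_pos hfL).trans ?_
  have h1 : (n : ℝ)⁻¹ * ∑ i, ∫ ω, ‖f i ω‖ ^ 2 ∂X.μ ≤ (n : ℝ)⁻¹ * ∑ i,
      (8 * metaLip L ρ G X.α ^ 2 * X.driftBound L σG σH G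
      + 2 * (adaptLip L X.α * L) ^ 2 * (∫ ω, ‖X.lag r i 0 ω‖ ^ 2 ∂X.μ
        + 2 * X.lagBound L σG σH G)) := by
    gcongr with i
    exact hfb i
  refine h1.trans_eq ?_
  have h2 := average_fin_const V.adm.n_pos (8 * metaLip L ρ G X.α ^ 2 * X.driftBound L σG σH G)
  have h3 := average_fin_const V.adm.n_pos (2 * X.lagBound L σG σH G)
  rw [smul_eq_mul] at h2 h3
  rw [Finset.sum_add_distrib, mul_add, h2, ← Finset.mul_sum, mul_left_comm,
    Finset.sum_add_distrib, mul_add (n : ℝ)⁻¹, h3, meanLag]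

/-- The expected decrease of the meta-objective in one local iteration. -/
theorem meanSqGrad_le (V : X.Valid L ρ σG σH G) (r : ℕ) {h : ℕ} (hh : h ≤ X.H) :
    X.η / 2 * X.meanSqGrad r h ≤ X.meanObjective r h - X.meanObjective r (h + 1)
      + X.η / 2 * (8 * metaLip L ρ G X.α ^ 2 * X.driftBound L σG σH G
        + 2 * (adaptLip L X.α * L) ^ 2 * (X.meanLag r + 2 * X.lagBound L σG σH G))
      + metaLip L ρ G X.α * X.η ^ 2 * directionBound L σG σH G X.α := by
  have := V.prob
  set g : Ω → Model d := fun ω => gradient (X.P.metaObjective X.α) (X.virtual r h ω) with hg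
  set q : Fin n → Ω → Model d := fun i ω =>
    X.P.metaGrad X.α i (X.loc r i h ω) (X.pers r i (h + 1) ω) with hq
  have hgL : MemLp g 2 X.μ := V.memLp_gradient (V.memLp_virtual r h).1
  have hqL : ∀ i, MemLp (q i) 2 X.μ := fun i => V.memLp_metaGrad r i h
  have hsL : ∀ i, MemLp (X.step r i h) 2 X.μ := fun i => V.memLp_step r i h
  have hqA := memLp_average hqL
  have hsA := memLp_average hsL
  have i0 := V.integrable_metaObjective (V.memLp_virtual r h)
  have i0' := V.integrable_metaObjective (V.memLp_virtual r (h + 1))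
  have i1 := integrable_inner_of_memLp_two hgL hsA
  have i2 := integrable_sq_norm_of_memLp_two hsA
  have i3 := integrable_inner_of_memLp_two hgL hqA
  have i4 := integrable_sq_norm_of_memLp_two hgL
  have i5 := integrable_sq_norm_of_memLp_two (hgL.sub hqA)
  have hpt : ∀ ω, X.P.metaObjective X.α (X.virtual r (h + 1) ω)
      ≤ X.P.metaObjective X.α (X.virtual r h ω)
        - X.η * ⟪g ω, (n : ℝ)⁻¹ • ∑ i, X.step r i h ω⟫
        + metaLip L ρ G X.α * X.η ^ 2 * ‖(n : ℝ)⁻¹ • ∑ i, X.step r i h ω‖ ^ 2 := by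
    intro ω
    have h1 := V.adm.metaObjective_le (X.virtual r h ω) (X.virtual r (h + 1) ω)
    rw [V.virtual_succ, sub_sub_cancel_left, inner_neg_right, inner_smul_right, norm_neg,
      norm_smul, mul_pow, Real.norm_eq_abs, sq_abs] at h1
    rw [V.virtual_succ]
    linarith
  have hdesc : X.meanObjective r (h + 1) ≤ X.meanObjective r h
      - X.η * ∫ ω, ⟪g ω, (n : ℝ)⁻¹ • ∑ i, X.step r i h ω⟫ ∂X.μ
      + metaLip L ρ G X.α * X.η ^ 2
        * ∫ ω, ‖(n : ℝ)⁻¹ • ∑ i, X.step r i h ω‖ ^ 2 ∂X.μ := by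
    have h1 := integral_le_of_le_add_add i0' i0 i1 i2 1 (-X.η) (metaLip L ρ G X.α * X.η ^ 2)
      fun ω => by linarith [hpt ω]
    unfold meanObjective
    linarith
  -- The gradient at the average model is determined before batches `1` and `2`, so each stochastic
  -- direction may be replaced by its conditional mean.
  have hcross : ∫ ω, ⟪g ω, (n : ℝ)⁻¹ • ∑ i, X.step r i h ω⟫ ∂X.μ
      = ∫ ω, ⟪g ω, (n : ℝ)⁻¹ • ∑ i, q i ω⟫ ∂X.μ := by
    simp only [inner_smul_right, inner_sum]
    rw [integral_const_mul, integral_const_mul,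
      integral_finsetSum _ fun i _ => integrable_inner_of_memLp_two hgL (hsL i),
      integral_finsetSum _ fun i _ => integrable_inner_of_memLp_two hgL (hqL i)]
    congr 1
    exact Finset.sum_congr rfl fun i _ => V.integral_inner_step r i h
      (V.measurable_gradient_virtual r h) fun ω => V.adm.norm_gradient_metaObjective_le _
  -- Polarization, `‖g‖² = 2⟪g, q⟫ + ‖g - q‖² - ‖q‖²`, with the last term dropped.
  have hpol : X.meanSqGrad r h ≤ 2 * ∫ ω, ⟪g ω, (n : ℝ)⁻¹ • ∑ i, q i ω⟫ ∂X.μ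
      + ∫ ω, ‖g ω - (n : ℝ)⁻¹ • ∑ i, q i ω‖ ^ 2 ∂X.μ := by
    refine (integral_le_of_le_add i4 i3 i5 2 1 fun ω => ?_).trans_eq (by rw [one_mul]; rfl)
    rw [Pi.sub_apply, norm_sub_sq_real]
    have := sq_nonneg ‖(n : ℝ)⁻¹ • ∑ i, q i ω‖
    linarith
  have hdist := V.integral_sq_norm_gradient_sub_le r hh
  have hstep := integral_sq_norm_average_le_of_le V.adm.n_pos hsL
    fun i => V.integral_sq_norm_step_le r i h
  have hLF := V.adm.metaLip_nonneg
  have hη := V.η_nonneg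
  rw [hcross] at hdesc
  have b1 := mul_le_mul_of_nonneg_left (hpol.trans (add_le_add_right hdist _))
    (by positivity : 0 ≤ X.η / 2)
  have b2 := mul_le_mul_of_nonneg_left hstep
    (by positivity : 0 ≤ metaLip L ρ G X.α * X.η ^ 2)
  linarith

end Valid

end Experiment

/-! ### Telescoping over iterations and rounds. -/

namespace Experiment

variable {n d K : ℕ} {Z Ω : Type*} [MeasurableSpace Z] [MeasurableSpace Ω]
  {X : Experiment n d K Z Ω} {L ρ σG σH G : ℝ}

namespace Valid

/-- Descent controls the gradient at every average model of the round, whereas the theorem concerns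
the server model. Lipschitz continuity transfers the bound at the price of the drift. -/
theorem meanSqGrad_zero_le (V : X.Valid L ρ σG σH G) (r : ℕ) {h : ℕ} (hh : h ≤ X.H) :
    X.meanSqGrad r 0 ≤ 2 * X.meanSqGrad r h
      + 2 * metaLip L ρ G X.α ^ 2 * X.driftBound L σG σH G := by
  have i0 := integrable_sq_norm_of_memLp_two (V.memLp_gradient (V.memLp_virtual r 0).1)
  have i1 := integrable_sq_norm_of_memLp_two (V.memLp_gradient (V.memLp_virtual r h).1)
  have i2 := integrable_sq_norm_of_memLp_two ((V.memLp_virtual r h).sub (V.memLp_glob r))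
  have h1 := integral_le_of_le_add i0 i1 i2 2 (2 * metaLip L ρ G X.α ^ 2) fun ω => by
    have h2 := sq_norm_sub_le_two_mul (gradient (X.P.metaObjective X.α) (X.virtual r h ω))
      (gradient (X.P.metaObjective X.α) (X.virtual r h ω)
        - gradient (X.P.metaObjective X.α) (X.virtual r 0 ω))
    rw [sub_sub_cancel] at h2
    refine h2.trans ?_
    rw [mul_assoc 2 (metaLip L ρ G X.α ^ 2), ← mul_pow, ← V.virtual_zero r]
    gcongr
    exact V.adm.norm_gradient_metaObjective_sub_le _ _
  have h3 := mul_le_mul_of_nonneg_left (V.integral_sq_norm_virtual_sub_glob_le r hh)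
    (by positivity : 0 ≤ 2 * metaLip L ρ G X.α ^ 2)
  exact h1.trans (add_le_add_right h3 _)

/-- The expected decrease of the meta-objective over the first `m` local iterations. -/
theorem meanSqGrad_mul_le (V : X.Valid L ρ σG σH G) (r : ℕ) {m : ℕ} (hm : m ≤ X.H) :
    X.η * m / 4 * X.meanSqGrad r 0 ≤ X.meanObjective r 0 - X.meanObjective r m
      + X.η * m * (5 * metaLip L ρ G X.α ^ 2 * X.driftBound L σG σH G
        + (adaptLip L X.α * L) ^ 2 * (X.meanLag r + 2 * X.lagBound L σG σH G)
        + metaLip L ρ G X.α * X.η * directionBound L σG σH G X.α) := by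
  induction m with
  | zero => simp
  | succ m ih =>
    have hm' : m ≤ X.H := (Nat.le_succ m).trans hm
    have h1 := V.meanSqGrad_le r hm'
    have h2 := mul_le_mul_of_nonneg_left (V.meanSqGrad_zero_le r hm')
      (div_nonneg V.η_nonneg (by norm_num : (0 : ℝ) ≤ 4))
    -- The drift enters with constant `4` from the descent and `1/2` from the transfer; this
    -- nonnegative quantity fills the gap to `5`.
    have h3 : 0 ≤ X.η * (metaLip L ρ G X.α ^ 2 * X.driftBound L σG σH G) :=
      mul_nonneg V.η_nonneg (mul_nonneg (sq_nonneg _) driftBound_nonneg)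
    have h4 := ih hm'
    push_cast
    linarith

theorem meanObjective_H (V : X.Valid L ρ σG σH G) (r : ℕ) :
    X.meanObjective r X.H = X.meanObjective (r + 1) 0 := by
  simp only [meanObjective, virtual_H, V.virtual_zero]

theorem sum_meanSqGrad_le (V : X.Valid L ρ σG σH G) (R : ℕ) :
    X.η * X.H / 4 * ∑ r ∈ Finset.range R, X.meanSqGrad r 0
      ≤ X.meanObjective 0 0 - X.meanObjective R 0
      + X.η * X.H * (R * (5 * metaLip L ρ G X.α ^ 2 * X.driftBound L σG σH G
        + 2 * (adaptLip L X.α * L) ^ 2 * X.lagBound L σG σH G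
        + metaLip L ρ G X.α * X.η * directionBound L σG σH G X.α)
        + (adaptLip L X.α * L) ^ 2 * ∑ r ∈ Finset.range R, X.meanLag r) := by
  induction R with
  | zero => simp
  | succ R ih =>
    have h1 := V.meanSqGrad_mul_le R (le_refl X.H)
    rw [V.meanObjective_H] at h1
    rw [Finset.sum_range_succ, Finset.sum_range_succ]
    push_cast
    linarith

/-- The convergence rate of LocalMOML. -/
theorem average_meanSqGrad_le (V : X.Valid L ρ σG σH G) (hη : 0 < X.η) (hH : 0 < X.H)
    (hβH : (1 - X.β) ^ X.H ≤ 1 / 4) {Δ U : ℝ}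
    (hbdd : BddBelow (Set.range (X.P.metaObjective X.α)))
    (hΔ : X.P.metaObjective X.α X.w₁ - ⨅ w, X.P.metaObjective X.α w ≤ Δ)
    (hU : X.meanLag 0 ≤ U) {R : ℕ} (hR : 0 < R) :
    (R : ℝ)⁻¹ * ∑ r ∈ Finset.range R, X.meanSqGrad r 0
      ≤ 4 * Δ / (X.η * X.H * R) + 8 * (adaptLip L X.α * L) ^ 2 * U / R
        + (20 * metaLip L ρ G X.α ^ 2 + 64 * (adaptLip L X.α * L) ^ 2 * adaptLip L X.α ^ 2)
          * X.driftBound L σG σH G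
        + 24 * (adaptLip L X.α * L) ^ 2 * X.lagBound L σG σH G
        + 4 * metaLip L ρ G X.α * directionBound L σG σH G X.α * X.η := by
  have := V.prob
  have h0 : X.meanObjective 0 0 = X.P.metaObjective X.α X.w₁ := by
    simp [meanObjective, V.virtual_zero, X.glob_zero]
  have h1 : ⨅ w, X.P.metaObjective X.α w ≤ X.meanObjective R 0 := by
    have h2 := integral_mono (μ := X.μ) (integrable_const (⨅ w, X.P.metaObjective X.α w))
      (V.integrable_metaObjective (V.memLp_virtual R 0)) fun ω => ciInf_le hbdd _
    simpa [meanObjective] using h2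
  have h2 := V.sum_meanSqGrad_le R
  have h3 := V.sum_meanLag_le hβH R
  set k2 := (adaptLip L X.α * L) ^ 2
  have hk : 0 ≤ k2 := sq_nonneg _
  have hH' : (0 : ℝ) < X.H := by exact_mod_cast hH
  have hR' : (0 : ℝ) < R := by exact_mod_cast hR
  have hηH : 0 < X.η * X.H := by positivity
  set b := 2 * X.lagBound L σG σH G + 8 * adaptLip L X.α ^ 2 * X.driftBound L σG σH G with hb
  have h4 : k2 * ∑ r ∈ Finset.range R, X.meanLag r ≤ k2 * (2 * U + R * (2 * b)) := by
    gcongr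
    linarith
  set S := ∑ r ∈ Finset.range R, X.meanSqGrad r 0
  set Q := 5 * metaLip L ρ G X.α ^ 2 * X.driftBound L σG σH G + 2 * k2 * X.lagBound L σG σH G
    + metaLip L ρ G X.α * X.η * directionBound L σG σH G X.α with hQ
  have h5 : X.η * X.H / 4 * S ≤ Δ + X.η * X.H * (R * Q + k2 * (2 * U + R * (2 * b))) := by
    have := mul_le_mul_of_nonneg_left h4 hηH.le
    rw [mul_add] at h2 ⊢
    linarith
  have h6 : S ≤ 4 * Δ / (X.η * X.H) + 4 * (R * Q + k2 * (2 * U + R * (2 * b))) := by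
    have e : 4 * Δ / (X.η * X.H) + 4 * (R * Q + k2 * (2 * U + R * (2 * b)))
        = (Δ + X.η * X.H * (R * Q + k2 * (2 * U + R * (2 * b)))) / (X.η * X.H / 4) := by
      field_simp
    rw [e, le_div_iff₀ (by positivity)]
    linarith
  rw [inv_mul_le_iff₀ hR']
  refine h6.trans_eq ?_
  -- After multiplication by `4` the drift has the constants `4 * 5 = 20` and `4 * 2 * 8 = 64`, and
  -- `lagBound` has `4 * (2 + 2 * 2) = 24`.
  rw [hQ, hb]
  field_simp
  ring

end Valid

end Experiment

/-! ### Choice of the parameters. -/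

/-- In powers of `ε`: `ηHR ~ ε⁻²`, `Hη ~ ε`, `β ~ ε²` and `η/β ~ ε`, while `1/R` and `η` are of
order `ε³ ≤ ε²`. The conditions `tβ`, `tη`, `tR` each allot `ε²/5` to a group of terms, in total
less than `ε²`. -/
theorem rate_le {k l F M s Δ U cβ cη cH cR ε H R : ℝ} (hF : 0 ≤ F) (hM : 0 ≤ M) (hΔ : 0 ≤ Δ)
    (hU : 0 ≤ U) (hβ0 : 0 < cβ) (hη0 : 0 < cη) (hη1 : cη ≤ 1) (hH0 : 0 < cH) (hR0 : 0 < cR)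
    (tβ : 48 * k ^ 2 * s ^ 2 * cβ ≤ 1 / 5)
    (tη : ((20 * F ^ 2 + 64 * k ^ 2 * l ^ 2) * M * (cH + 1) ^ 2
      + 48 * k ^ 2 * l ^ 2 * M / cβ ^ 2 + 4 * F * M) * cη ≤ 1 / 5)
    (tR : (4 * Δ / (cη * cH) + 8 * k ^ 2 * U) / cR ≤ 1 / 5)
    (hε : 0 < ε) (hε1 : ε ≤ 1) (hH : cH / ε ^ 2 ≤ H) (hH' : H ≤ (cH + 1) / ε ^ 2)
    (hR : cR / ε ^ 3 ≤ R) :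
    4 * Δ / (cη * ε ^ 3 * H * R) + 8 * k ^ 2 * U / R
      + (20 * F ^ 2 + 64 * k ^ 2 * l ^ 2) * ((H * (cη * ε ^ 3)) ^ 2 * M)
      + 24 * k ^ 2 * (2 * (cβ * ε ^ 2) * s ^ 2
        + 2 * l ^ 2 * M * ((cη * ε ^ 3) ^ 2 / (cβ * ε ^ 2) ^ 2))
      + 4 * F * M * (cη * ε ^ 3) ≤ ε ^ 2 := by
  have hε2 : 0 < ε ^ 2 := by positivity
  have hε3 : 0 < ε ^ 3 := by positivity
  have hε32 : ε ^ 3 ≤ ε ^ 2 := pow_le_pow_of_le_one hε.le hε1 (by norm_num)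
  have hHpos : 0 < H := lt_of_lt_of_le (by positivity) hH
  have hRpos : 0 < R := lt_of_lt_of_le (by positivity) hR
  -- Two terms are quadratic in `cη`; with `cη ≤ 1` the condition `tη`, linear in `cη`, covers them
  -- as well.
  have hηη : cη ^ 2 ≤ cη := by nlinarith
  have s1 : 4 * Δ / (cη * ε ^ 3 * H * R) ≤ 4 * Δ / (cη * cH) / cR * ε ^ 2 := by
    have h1 : cη * ε ^ 3 * (cH / ε ^ 2) * (cR / ε ^ 3) ≤ cη * ε ^ 3 * H * R := by gcongr
    have h2 : 4 * Δ / (cη * cH) / cR * ε ^ 2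
        = 4 * Δ / (cη * ε ^ 3 * (cH / ε ^ 2) * (cR / ε ^ 3)) := by
      field_simp
    rw [h2]
    exact div_le_div_of_nonneg_left (by positivity) (by positivity) h1
  have s2 : 8 * k ^ 2 * U / R ≤ 8 * k ^ 2 * U / cR * ε ^ 2 := by
    calc 8 * k ^ 2 * U / R ≤ 8 * k ^ 2 * U / (cR / ε ^ 3) :=
          div_le_div_of_nonneg_left (by positivity) (by positivity) hR
      _ = 8 * k ^ 2 * U / cR * ε ^ 3 := by field_simp
      _ ≤ _ := by gcongr
  have s12 : 4 * Δ / (cη * ε ^ 3 * H * R) + 8 * k ^ 2 * U / R ≤ 1 / 5 * ε ^ 2 := by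
    refine (add_le_add s1 s2).trans ?_
    rw [← add_mul, ← add_div]
    gcongr
  have s3 : (20 * F ^ 2 + 64 * k ^ 2 * l ^ 2) * ((H * (cη * ε ^ 3)) ^ 2 * M)
      ≤ (20 * F ^ 2 + 64 * k ^ 2 * l ^ 2) * M * (cH + 1) ^ 2 * cη * ε ^ 2 := by
    have h1 : H * (cη * ε ^ 3) ≤ (cH + 1) * cη * ε := by
      calc H * (cη * ε ^ 3) ≤ (cH + 1) / ε ^ 2 * (cη * ε ^ 3) := by gcongr
        _ = _ := by field_simp
    calc _ ≤ (20 * F ^ 2 + 64 * k ^ 2 * l ^ 2) * (((cH + 1) * cη * ε) ^ 2 * M) := by gcongr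
      _ = (20 * F ^ 2 + 64 * k ^ 2 * l ^ 2) * M * (cH + 1) ^ 2 * cη ^ 2 * ε ^ 2 := by ring
      _ ≤ _ := by gcongr
  have s4 : 24 * k ^ 2 * (2 * (cβ * ε ^ 2) * s ^ 2
            + 2 * l ^ 2 * M * ((cη * ε ^ 3) ^ 2 / (cβ * ε ^ 2) ^ 2))
      ≤ 48 * k ^ 2 * s ^ 2 * cβ * ε ^ 2 + 48 * k ^ 2 * l ^ 2 * M / cβ ^ 2 * cη * ε ^ 2 := by
    calc _ = 48 * k ^ 2 * s ^ 2 * cβ * ε ^ 2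
          + 48 * k ^ 2 * l ^ 2 * M / cβ ^ 2 * cη ^ 2 * ε ^ 2 := by
          field_simp; ring
      _ ≤ _ := by gcongr
  have s5 : 4 * F * M * (cη * ε ^ 3) ≤ 4 * F * M * cη * ε ^ 2 := by
    rw [← mul_assoc]; gcongr
  have u1 := mul_le_mul_of_nonneg_right tβ hε2.le
  have u2 := mul_le_mul_of_nonneg_right tη hε2.le
  rw [add_mul, add_mul, add_mul, add_mul] at u2
  linarith

/-- The choice `1 / (1 + 5A)` makes sense also for `A = 0` and never exceeds `1`. -/
theorem mul_one_div_one_add_le {A : ℝ} (hA : 0 ≤ A) : A * (1 / (1 + 5 * A)) ≤ 1 / 5 := by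
  rw [mul_one_div, div_le_div_iff₀ (by positivity) (by norm_num)]; linarith

theorem one_div_one_add_le_one {A : ℝ} (hA : 0 ≤ A) : 1 / (1 + 5 * A) ≤ 1 := by
  rw [div_le_one (by positivity)]; linarith

/-- A choice of the parameters for which the convergence rate of LocalMOML is at most `ε ^ 2`. -/
theorem exists_rates (k l s : ℝ) {F M Δ U : ℝ} (hF : 0 ≤ F) (hM : 0 ≤ M) (hΔ : 0 ≤ Δ)
    (hU : 0 ≤ U) :
    ∃ cβ cη cH cR : ℝ, 0 < cβ ∧ 0 < cη ∧ 0 < cH ∧ 0 < cR ∧ cβ ≤ 1 ∧ 2 ≤ cβ * cH ∧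
      ∀ ε : ℝ, 0 < ε → ε ≤ 1 → ∀ H R : ℝ, cH / ε ^ 2 ≤ H → H ≤ (cH + 1) / ε ^ 2 → cR / ε ^ 3 ≤ R →
        4 * Δ / (cη * ε ^ 3 * H * R) + 8 * k ^ 2 * U / R
          + (20 * F ^ 2 + 64 * k ^ 2 * l ^ 2) * ((H * (cη * ε ^ 3)) ^ 2 * M)
          + 24 * k ^ 2 * (2 * (cβ * ε ^ 2) * s ^ 2
            + 2 * l ^ 2 * M * ((cη * ε ^ 3) ^ 2 / (cβ * ε ^ 2) ^ 2))
          + 4 * F * M * (cη * ε ^ 3) ≤ ε ^ 2 := by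
  have hA : 0 ≤ 48 * k ^ 2 * s ^ 2 := by positivity
  -- The order of the choices matters: `cH` depends on `cβ` through the forgetting condition `cβ *
  -- cH ≥ 2`, `cη` on both, and `cR` on `cη` and `cH`.
  obtain ⟨cβ, hβ0, hβ1, tβ⟩ : ∃ c : ℝ, 0 < c ∧ c ≤ 1 ∧ 48 * k ^ 2 * s ^ 2 * c ≤ 1 / 5 :=
    ⟨_, by positivity, one_div_one_add_le_one hA, mul_one_div_one_add_le hA⟩
  obtain ⟨cH, hH0, hβH⟩ : ∃ c : ℝ, 0 < c ∧ 2 ≤ cβ * c :=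
    ⟨2 / cβ, by positivity, by rw [mul_div_cancel₀ _ hβ0.ne']⟩
  have hB : 0 ≤ (20 * F ^ 2 + 64 * k ^ 2 * l ^ 2) * M * (cH + 1) ^ 2
      + 48 * k ^ 2 * l ^ 2 * M / cβ ^ 2 + 4 * F * M := by positivity
  obtain ⟨cη, hη0, hη1, tη⟩ : ∃ c : ℝ, 0 < c ∧ c ≤ 1 ∧
      ((20 * F ^ 2 + 64 * k ^ 2 * l ^ 2) * M * (cH + 1) ^ 2
        + 48 * k ^ 2 * l ^ 2 * M / cβ ^ 2 + 4 * F * M) * c ≤ 1 / 5 :=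
    ⟨_, by positivity, one_div_one_add_le_one hB, mul_one_div_one_add_le hB⟩
  have hD : 0 ≤ 4 * Δ / (cη * cH) + 8 * k ^ 2 * U := by positivity
  obtain ⟨cR, hR0, tR⟩ : ∃ c : ℝ, 0 < c ∧ (4 * Δ / (cη * cH) + 8 * k ^ 2 * U) / c ≤ 1 / 5 :=
    ⟨1 + 5 * (4 * Δ / (cη * cH) + 8 * k ^ 2 * U), by positivity, by
      rw [← mul_one_div]; exact mul_one_div_one_add_le hD⟩
  exact ⟨cβ, cη, cH, cR, hβ0, hη0, hH0, hR0, hβ1, hβH, fun ε hε hε1 H R hH hH' hR =>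
    rate_le hF hM hΔ hU hβ0 hη0 hη1 hH0 hR0 tβ tη tR hε hε1 hH hH' hR⟩

/-- The personalized models forget their state at the beginning of a round. -/
theorem one_sub_pow_le_quarter {β : ℝ} {H : ℕ} (h1 : β ≤ 1) (h2 : 2 ≤ β * H) :
    (1 - β) ^ H ≤ 1 / 4 := by
  calc (1 - β) ^ H ≤ Real.exp (-β) ^ H :=
        pow_le_pow_left₀ (by linarith) (Real.one_sub_le_exp_neg β) H
    _ = Real.exp (-(β * H)) := by rw [← Real.exp_nat_mul]; ring_nf
    _ ≤ Real.exp (-2) := Real.exp_le_exp.2 (by linarith)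
    _ ≤ 1 / 4 := by
        have h3 : (2 : ℝ) ≤ Real.exp 1 := by linarith [Real.add_one_le_exp (1 : ℝ)]
        have h4 : Real.exp 2 = Real.exp 1 * Real.exp 1 := by rw [← Real.exp_add]; norm_num
        rw [Real.exp_neg, ← one_div]
        exact one_div_le_one_div_of_le (by norm_num) (by rw [h4]; nlinarith)

/-! ### Counting rounds, iterations and samples. -/

section Counts

variable {n d K : ℕ} {Z : Type*} [MeasurableSpace Z] (P : Tasks n d Z) (α β η : ℝ)

theorem localSteps_counts (i : Fin n) (S : ℕ → Fin 3 → Fin K → Z) (s : ClientState d) (h : ℕ) :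
    (localSteps P α β η i S s h).iterations = s.iterations + h ∧
      (localSteps P α β η i S s h).samples = s.samples + 3 * K * h := by
  induction h with
  | zero => exact ⟨rfl, rfl⟩
  | succ h ih =>
    simp only [localSteps, localStep, ih]
    constructor <;> ring

theorem localMOML_counts (H : ℕ) (w₁ : Model d) (u₀ : Fin n → Model d)
    (z : SampleIndex n K → Z) (r : ℕ) :
    (localMOML P α β η H w₁ u₀ z r).rounds = r ∧
      (∀ i, (localMOML P α β η H w₁ u₀ z r).iterations i = r * H) ∧
      ∀ i, (localMOML P α β η H w₁ u₀ z r).samples i = 3 * K * (r * H) := by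
  induction r with
  | zero => simp [localMOML]
  | succ r ih =>
    obtain ⟨h1, h2, h3⟩ := ih
    refine ⟨by simp [localMOML, round, h1], fun i => ?_, fun i => ?_⟩
    · simp only [localMOML, round, (localSteps_counts ..).1, h2]
      ring
    · simp only [localMOML, round, (localSteps_counts ..).2, h3]
      ring

end Counts

/-! ### Measurable modifications, the uniform round, and rounding. -/

theorem RunData.congr {n d K : ℕ} {Z Ω : Type*} [MeasurableSpace Z] [MeasurableSpace Ω]
    {μ : Measure Ω} {P : Tasks n d Z} {S S' : SampleIndex n K → Ω → Z}
    {u₀ u₀' : Fin n → Ω → Model d} (h : RunData μ P K S u₀) (hS : ∀ j, S j =ᵐ[μ] S' j)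
    (hu : ∀ i, u₀ i =ᵐ[μ] u₀' i) : RunData μ P K S' u₀' where
  law j := (h.law j).congr (hS j).symm
  indep := h.indep.congr hS
  memLp_init i := (h.memLp_init i).ae_eq (hu i)
  indep_init := by
    refine h.indep_init.congr ?_ ?_
    · filter_upwards [ae_all_iff.2 hu] with ω hω using funext hω
    · filter_upwards [ae_all_iff.2 hS] with ω hω using funext hω

/-- The samples and the initial models of a run can be modified on a null set such that they become
measurable. -/
theorem RunData.exists_measurable {n d K : ℕ} {Z Ω : Type*} [MeasurableSpace Z]
    [MeasurableSpace Ω] {μ : Measure Ω} {P : Tasks n d Z} {S : SampleIndex n K → Ω → Z}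
    {u₀ : Fin n → Ω → Model d} (h : RunData μ P K S u₀) :
    ∃ (S' : SampleIndex n K → Ω → Z) (u₀' : Fin n → Ω → Model d),
      (∀ j, Measurable (S' j)) ∧ (∀ i, Measurable (u₀' i)) ∧ RunData μ P K S' u₀' ∧
      (∀ j, S j =ᵐ[μ] S' j) ∧ ∀ i, u₀ i =ᵐ[μ] u₀' i :=
  ⟨fun j => (h.law j).aemeasurable.mk, fun i => (h.memLp_init i).1.mk,
    fun j => (h.law j).aemeasurable.measurable_mk,
    fun i => (h.memLp_init i).1.stronglyMeasurable_mk.measurable,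
    h.congr (fun j => (h.law j).aemeasurable.ae_eq_mk) fun i => (h.memLp_init i).1.ae_eq_mk,
    fun j => (h.law j).aemeasurable.ae_eq_mk, fun i => (h.memLp_init i).1.ae_eq_mk⟩

/-- A bound `ε ^ 2` of the mean square over a uniform round gives a bound `ε` of the mean. -/
theorem expectAtUniformRound_le_of_sq {Ω : Type*} [MeasurableSpace Ω] {μ : Measure Ω}
    [IsProbabilityMeasure μ] {R : ℕ} (hR : 0 < R) {f : ℕ → Ω → ℝ} {ε : ℝ} (hε : 0 < ε)
    (hf : ∀ r, Integrable (f r) μ) (hf2 : ∀ r, Integrable (fun ω => f r ω ^ 2) μ)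
    (h : expectAtUniformRound μ R (fun r ω => f r ω ^ 2) ≤ ε ^ 2) :
    expectAtUniformRound μ R f ≤ ε := by
  -- The inequality `x ≤ x²/(2ε) + ε/2` replaces Jensen's inequality for the run and the uniform
  -- round at once.
  have h1 : ∀ r, ∫ ω, f r ω ∂μ ≤ (2 * ε)⁻¹ * ∫ ω, f r ω ^ 2 ∂μ + ε / 2 := by
    intro r
    have h2 := integral_le_of_le_add (hf r) (hf2 r) (integrable_const (1 : ℝ)) (2 * ε)⁻¹ (ε / 2)
      fun ω => by
        have h3 : 0 ≤ (2 * ε)⁻¹ * (f r ω - ε) ^ 2 := by positivity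
        have h4 : (2 * ε)⁻¹ * (f r ω - ε) ^ 2
            = (2 * ε)⁻¹ * f r ω ^ 2 + ε / 2 * 1 - f r ω := by
          field_simp; ring
        linarith
    simpa using h2
  have hR' : (0 : ℝ) < R := by exact_mod_cast hR
  unfold expectAtUniformRound at h ⊢
  calc (R : ℝ)⁻¹ * ∑ r ∈ Finset.range R, ∫ ω, f r ω ∂μ
      ≤ (R : ℝ)⁻¹ * ∑ r ∈ Finset.range R, ((2 * ε)⁻¹ * ∫ ω, f r ω ^ 2 ∂μ + ε / 2) := by
        gcongr with r
        exact h1 r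
    _ = (2 * ε)⁻¹ * ((R : ℝ)⁻¹ * ∑ r ∈ Finset.range R, ∫ ω, f r ω ^ 2 ∂μ) + ε / 2 := by
        rw [Finset.sum_add_distrib, ← Finset.mul_sum, Finset.sum_const, Finset.card_range,
          nsmul_eq_mul]
        field_simp
    _ ≤ (2 * ε)⁻¹ * ε ^ 2 + ε / 2 := by gcongr
    _ = ε := by field_simp; ring

/-- The rounding error is at most `1 ≤ 1/ε^m`, so it only raises the constant. -/
theorem natCeil_div_pow_le {c ε : ℝ} (hc : 0 ≤ c) (hε : 0 < ε) (hε1 : ε ≤ 1) (m : ℕ) :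
    (⌈c / ε ^ m⌉₊ : ℝ) ≤ (c + 1) / ε ^ m := by
  have h1 : (1 : ℝ) ≤ 1 / ε ^ m := by
    rw [le_div_iff₀ (by positivity), one_mul]; exact pow_le_one₀ hε.le hε1
  have h2 := (Nat.ceil_lt_add_one (by positivity : 0 ≤ c / ε ^ m)).le
  rw [add_div]
  linarith

end MetaLearning

/-! ### Assembly of the theorem. -/

open MetaLearning

theorem mainTheorem5
    (L ρ σG σH G α Δ U : ℝ) (hL : 0 ≤ L) (hρ : 0 ≤ ρ) (hσG : 0 ≤ σG) (hσH : 0 ≤ σH)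
    (hG : 0 ≤ G) (hα : 0 ≤ α) (hΔ : 0 ≤ Δ) (hU : 0 ≤ U) :
    ∃ cβ cη cH cR C : ℝ, 0 < cβ ∧ 0 < cη ∧ 0 < cH ∧ 0 < cR ∧ 0 < C ∧
      ∀ (n d : ℕ) (Z Ω : Type*) [MeasurableSpace Z] [MeasurableSpace Ω]
        (P : MetaLearning.Tasks n d Z) (w₁ : MetaLearning.Model d)
        (μ : Measure Ω) [IsProbabilityMeasure μ]
        (K : ℕ) (S : MetaLearning.SampleIndex n K → Ω → Z)
        (u₀ : Fin n → Ω → MetaLearning.Model d),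
        0 < n → 0 < K →
        P.Regular → P.SmoothRisks L ρ → P.BoundedVariance σG σH → P.BoundedGradients G →
        BddBelow (Set.range (P.metaObjective α)) →
        P.metaObjective α w₁ - ⨅ w, P.metaObjective α w ≤ Δ →
        MetaLearning.RunData μ P K S u₀ →
        (n : ℝ)⁻¹ * ∑ i, ∫ ω, ‖u₀ i ω - P.adapt α i w₁‖ ^ 2 ∂μ ≤ U →
        ∀ (ε : ℝ), 0 < ε → ε ≤ 1 →
        ∀ (β η : ℝ) (H R : ℕ),
          β = cβ * ε ^ 2 → η = cη * ε ^ 3 → H = ⌈cH / ε ^ 2⌉₊ → R = ⌈cR / ε ^ 3⌉₊ →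
          ∀ (run : ℕ → Ω → MetaLearning.SystemState n d),
          (∀ r ω, run r ω =
            MetaLearning.localMOML P α β η H w₁ (fun i => u₀ i ω) (fun j => S j ω) r) →
          β ≤ 1 ∧
          (∀ r, Integrable (fun ω => ‖gradient (P.metaObjective α) (run r ω).w‖ ^ 2) μ) ∧
          MetaLearning.expectAtUniformRound μ R
            (fun r ω => ‖gradient (P.metaObjective α) (run r ω).w‖ ^ 2) ≤ ε ^ 2 ∧
          MetaLearning.expectAtUniformRound μ R
            (fun r ω => ‖gradient (P.metaObjective α) (run r ω).w‖) ≤ ε ∧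
          (∀ ω,
            ((run R ω).rounds : ℝ) ≤ C / ε ^ 3 ∧
            (∀ i, ((run R ω).iterations i : ℝ) ≤ C / ε ^ 5) ∧
            ((∑ i, (run R ω).samples i : ℕ) : ℝ) ≤ C * K * n / ε ^ 5) := by
  have hF : 0 ≤ metaLip L ρ G α := by unfold metaLip adaptLip; positivity
  obtain ⟨cβ, cη, cH, cR, hβ0, hη0, hH0, hR0, hβ1, hβH, hrate⟩ :=
    exists_rates (adaptLip L α * L) (adaptLip L α) (α * σG) hF
      (directionBound_nonneg L σG σH G α) hΔ hU
  -- The factor `3` counts the three batches of an iteration; the other two bound `H ε²` and `R ε³`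
  -- after rounding.
  refine ⟨cβ, cη, cH, cR, 3 * (cH + 1) * (cR + 1), hβ0, hη0, hH0, hR0, by positivity, ?_⟩
  intro n d Z Ω _ _ P w₁ μ _ K S u₀ hn hK hreg hsm hvar hbg hbdd hgap hrun hinit ε hε hε1 β η H R
    hβ hη hHc hRc run hrunEq
  have hβle : β ≤ 1 := by
    rw [hβ]; exact mul_le_one₀ hβ1 (by positivity) (pow_le_one₀ hε.le hε1)
  have hHlow : cH / ε ^ 2 ≤ H := hHc ▸ Nat.le_ceil _
  have hRlow : cR / ε ^ 3 ≤ R := hRc ▸ Nat.le_ceil _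
  have hHup : (H : ℝ) ≤ (cH + 1) / ε ^ 2 := hHc ▸ natCeil_div_pow_le hH0.le hε hε1 2
  have hRup : (R : ℝ) ≤ (cR + 1) / ε ^ 3 := hRc ▸ natCeil_div_pow_le hR0.le hε hε1 3
  have hHpos : 0 < H := by
    have : (0 : ℝ) < H := lt_of_lt_of_le (by positivity) hHlow
    exact_mod_cast this
  have hRpos : 0 < R := by
    have : (0 : ℝ) < R := lt_of_lt_of_le (by positivity) hRlow
    exact_mod_cast this
  -- The data of a run are only almost everywhere measurable, while the histories need measurable
  -- generators.
  obtain ⟨S', u₀', hmS, hmu, hrun', hSS, huu⟩ := hrun.exists_measurable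
  let X : Experiment n d K Z Ω :=
    { P := P, α := α, β := β, η := η, H := H, w₁ := w₁, u₀ := u₀', S := S', μ := μ }
  have V : X.Valid L ρ σG σH G :=
    { adm := ⟨hn, hL, hρ, hG, hα, hreg, hsm, hvar, hbg⟩
      K_pos := hK
      prob := ‹_›
      β_pos := by show 0 < β; rw [hβ]; positivity
      β_le := hβle
      η_nonneg := by show 0 ≤ η; rw [hη]; positivity
      meas_S := hmS
      meas_u₀ := hmu
      run := hrun' }
  have hae : ∀ r, (fun ω => gradient (P.metaObjective α) (X.virtual r 0 ω))
      =ᵐ[μ] fun ω => gradient (P.metaObjective α) (run r ω).w := by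
    intro r
    -- There are countably many samples, so off one null set all modifications are invisible and
    -- both runs coincide.
    filter_upwards [ae_all_iff.2 hSS, ae_all_iff.2 huu] with ω h1 h2
    rw [V.virtual_zero, hrunEq]
    simp only [Experiment.glob, Experiment.server, X, h1, h2]
  have hL2 : ∀ r, MemLp (fun ω => gradient (P.metaObjective α) (run r ω).w) 2 μ := fun r =>
    (V.memLp_gradient (V.memLp_virtual r 0).1).ae_eq (hae r)
  have hsq : expectAtUniformRound μ R
      (fun r ω => ‖gradient (P.metaObjective α) (run r ω).w‖ ^ 2) ≤ ε ^ 2 := by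
    have hpow : (1 - β) ^ H ≤ 1 / 4 := by
      refine one_sub_pow_le_quarter hβle (hβH.trans ?_)
      -- The powers of `ε` cancel in `βH`, so a round is long enough to forget the old lag for every
      -- `ε`.
      calc cβ * cH = cβ * ε ^ 2 * (cH / ε ^ 2) := by field_simp
        _ ≤ β * H := by rw [hβ]; gcongr
    have hlag : X.meanLag 0 ≤ U := by
      refine le_of_eq_of_le ?_ hinit
      unfold Experiment.meanLag
      congr 1
      refine Finset.sum_congr rfl fun i _ => integral_congr_ae ?_
      filter_upwards [huu i] with ω hω
      -- At the start of round `0` every local model is `w₁`, so the lag is the initial error by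
      -- definition.
      rw [hω]; rfl
    have h1 := V.average_meanSqGrad_le (by show 0 < η; rw [hη]; positivity) hHpos hpow hbdd hgap
      hlag hRpos
    have h2 := hrate ε hε hε1 H R hHlow hHup hRlow
    have h3 : expectAtUniformRound μ R
        (fun r ω => ‖gradient (P.metaObjective α) (run r ω).w‖ ^ 2)
        = (R : ℝ)⁻¹ * ∑ r ∈ Finset.range R, X.meanSqGrad r 0 := by
      unfold expectAtUniformRound Experiment.meanSqGrad
      congr 1
      refine Finset.sum_congr rfl fun r _ => integral_congr_ae ?_
      filter_upwards [hae r] with ω hω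
      rw [← hω]
    rw [h3]
    refine h1.trans (le_trans (le_of_eq ?_) h2)
    simp only [Experiment.driftBound, Experiment.lagBound, X, hβ, hη]
  refine ⟨hβle, fun r => integrable_sq_norm_of_memLp_two (hL2 r), hsq,
    expectAtUniformRound_le_of_sq hRpos hε (fun r => ((hL2 r).integrable one_le_two).norm)
      (fun r => integrable_sq_norm_of_memLp_two (hL2 r)) hsq, fun ω => ?_⟩
  -- The counters are deterministic, so the complexity bounds hold for every `ω` and for the
  -- original, unmodified run.
  obtain ⟨c1, c2, c3⟩ := localMOML_counts P α β η H w₁ (fun i => u₀ i ω) (fun j => S j ω) R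
  have hRH : (R : ℝ) * H ≤ (cH + 1) * (cR + 1) / ε ^ 5 := by
    calc (R : ℝ) * H ≤ (cR + 1) / ε ^ 3 * ((cH + 1) / ε ^ 2) := by gcongr
      _ = _ := by field_simp
  have hpos : 0 ≤ (cH + 1) * (cR + 1) := by positivity
  rw [hrunEq]
  refine ⟨?_, fun i => ?_, ?_⟩
  · rw [c1]
    refine hRup.trans ?_
    gcongr
    nlinarith
  · rw [c2]
    push_cast
    refine hRH.trans ?_
    gcongr
    linarith
  · rw [Finset.sum_congr rfl fun i _ => c3 i]
    simp only [Finset.sum_const, Finset.card_univ, Fintype.card_fin, smul_eq_mul]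
    push_cast
    calc (n : ℝ) * (3 * K * (R * H)) = 3 * K * n * (R * H) := by ring
      _ ≤ 3 * K * n * ((cH + 1) * (cR + 1) / ε ^ 5) := by gcongr
      _ = _ := by ring
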